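/- Let $n\in\mathbb N$, $A\ge 1$ and $B>0$. There is a constant $C>0$, depending only on $n$, $A$ and $B$, with the following property. Let $S\in\mathbb R[x,y]$ be a real polynomial of degree at most $n$, and put $H=\partial_x\partial_y(\partial_x-\partial_y)S$. Let $a<b$ be real numbers, let $\alpha,\beta$ be continuous monotone functions on $[a,b]$ (each of them nondecreasing or nonincreasing) with $\alpha(y)<\beta(y)$ for all $y\in(a,b)$, and let $\Omega$ be the curved trapezoid $$\Omega=\{(x,y)\in\mathbb R^2:\ a<y<b,\ \alpha(y)<x<\beta(y)\}.$$ For $y\in(a,b)$ let $\tau(y)$ be the length of the cross section $\{x\in\mathbb R:(x,y)\in\Omega\}$. Let $\varphi:\mathbb R^2\to\mathbb C$ be a measurable function and $\mu>0$ a real number such that (i) for each $y\in(a,b)$, the function $\varphi(\cdot,y)$ is $C^\infty$ on $\mathbb R$ with support contained in $[\alpha(y),\beta(y)]$, and $$\sup_{(x,y)\in\Omega}\ \sum_{k=0}^{2}\tau(y)^k\,|\partial_x^k\varphi(x,y)|\le B;$$ (ii) $\mu\le|H(x,y)|\le A\mu$ for all $(x,y)\in\Omega$. Then for all real $\lambda\ne0$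 and all $f,g,h\in L^2(\mathbb R)$ (complex valued), the integral $$\Lambda_{\lambda,\Omega}(f,g,h)=\iint_{\mathbb R^2} e^{i\lambda S(x,y)}f(x)\,g(y)\,h(x+y)\,\chi_\Omega(x,y)\,\varphi(x,y)\,dx\,dy$$ converges absolutely, and $$|\Lambda_{\lambda,\Omega}(f,g,h)|\le C\,|\lambda\mu|^{-1/6}\,\|f\|_2\,\|g\|_2\,\|h\|_2 .$$ -/

import Mathlib

open MeasureTheory
open scoped ContDiff

noncomputable section

namespace TrilinearVdC

/-- The value `P(x, y)` of a real polynomial in two variables (variable `0` is `x`, variable `1`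
is `y`). -/
def evalXY (P : MvPolynomial (Fin 2) ℝ) (x y : ℝ) : ℝ :=
  MvPolynomial.eval ![x, y] P

/-- The polynomial `H = ∂ₓ ∂ᵧ (∂ₓ - ∂ᵧ) S`. -/
def mixedH (S : MvPolynomial (Fin 2) ℝ) : MvPolynomial (Fin 2) ℝ :=
  MvPolynomial.pderiv 0 (MvPolynomial.pderiv 1 (MvPolynomial.pderiv 0 S - MvPolynomial.pderiv 1 S))

/-- Admissible data `a, b, α, β` for a curved trapezoid: `a < b`, the functions `α` and `β` are
continuous and monotone on `[a, b]` (each of them nondecreasing or nonincreasing, independently),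
and `α < β` on `(a, b)`. -/
structure IsTrapezoidData (a b : ℝ) (α β : ℝ → ℝ) : Prop where
  lt : a < b
  continuousOn_left : ContinuousOn α (Set.Icc a b)
  continuousOn_right : ContinuousOn β (Set.Icc a b)
  monotone_left : MonotoneOn α (Set.Icc a b) ∨ AntitoneOn α (Set.Icc a b)
  monotone_right : MonotoneOn β (Set.Icc a b) ∨ AntitoneOn β (Set.Icc a b)
  left_lt_right : ∀ y ∈ Set.Ioo a b, α y < β y

/-- The curved trapezoid `{(x, y) : a < y < b, α(y) < x < β(y)}`. -/
def trapezoid (a b : ℝ) (α β : ℝ → ℝ) : Set (ℝ × ℝ) :=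
  {p | p.2 ∈ Set.Ioo a b ∧ p.1 ∈ Set.Ioo (α p.2) (β p.2)}

/-- The length `τ(y)` of the horizontal cross section `{x : (x, y) ∈ Ω}`. -/
def sectionLength (Ω : Set (ℝ × ℝ)) (y : ℝ) : ℝ :=
  volume.real {x : ℝ | (x, y) ∈ Ω}

/-- The integrand `e^{iλS(x,y)} f(x) g(y) h(x+y) χ_Ω(x,y) φ(x,y)`. -/
def integrand (lam : ℝ) (S : MvPolynomial (Fin 2) ℝ) (Ω : Set (ℝ × ℝ)) (φ : ℝ → ℝ → ℂ)
    (f g h : ℝ → ℂ) (p : ℝ × ℝ) : ℂ :=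
  Complex.exp (Complex.I * ((lam * evalXY S p.1 p.2 : ℝ) : ℂ)) *
    f p.1 * g p.2 * h (p.1 + p.2) * Ω.indicator (fun _ => (1 : ℂ)) p * φ p.1 p.2

/-- The localized trilinear form `Λ_{λ,Ω}(f, g, h)`. -/
def form (lam : ℝ) (S : MvPolynomial (Fin 2) ℝ) (Ω : Set (ℝ × ℝ)) (φ : ℝ → ℝ → ℂ)
    (f g h : ℝ → ℂ) : ℂ :=
  ∫ p : ℝ × ℝ, integrand lam S Ω φ f g h p

/-- The norm of `f` in `L²(ℝ)`; only used for `f` with `MemLp f 2`. -/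
def normL2 (f : ℝ → ℂ) : ℝ :=
  (eLpNorm f 2 volume).toReal

end TrilinearVdC

end

/-!
The bound comes from two applications of the `TT*` method and one van der Corput estimate, after the
trapezoid has been cut into a bounded number of pieces on which `H` is under control.

Write the form as a pairing of `h` with `u ↦ ∫ w(u, y) dy`, where `u = x + y`. Squaring removes `h`
and leaves an integral over the difference `t` of the two copies of `y`, of bilinear forms in
`F(x) = f(x) f̄(x + t)` and `G(y) = g(y) ḡ(y - t)` with phase `S(x, y) - S(x + t, y - t)`. Squaring
once more removes `F`; the remaining kernel in `(y, y')` is an oscillatory integral in `x`, and the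
`x`-derivative of its phase is a mixed second difference of `∂ₓS`. By the mean value theorem
(`exists_second_difference_eq`) it equals, up to sign, `(y - y') t H` at some point of an
antidiagonal segment. The monotonicity of the boundary curves guarantees that the ends of this
segment lie in the trapezoid (`IsTrapezoidData.inTrapezoid_of_mem_uIcc`), so that `|H| ≈ μ` there as
soon as antidiagonal chords are good in the sense of `HasGoodChords`. Two integrations by parts, with
Markov's inequality for the derivatives of the polynomial phase (`exists_norm_kernel_le`), bound the
kernel by `τ / (1 + (τ μ |t| |y - y'|)²)`, with `τ` the width of the shortest section involved. This
is an average of variable width, which is bounded on `L²` uniformly in the widths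
(`lintegral_cauchyBump_mul_mul_le`), and the bilinear forms are `O((μ |t|)^(-1/2)) ‖F‖₂ ‖G‖₂`. This
is used for `|t| > μ^(-1/3)` and the trivial bound for smaller `t`; as `‖F‖₂` and `‖G‖₂` are square
integrable in `t`, the square of the form is `O(μ^(-1/3))` (`exists_enorm_trilinear_sq_le`).

An antidiagonal chord may leave the trapezoid, and then the hypothesis on `H` says nothing about it.
The polynomial `E = (H² - μ²/4)(4A²μ² - H²)` is at least `κ = 9A²μ⁴/4` on the trapezoid, and `E > 0`
implies `μ/2 < |H| < 2Aμ`. If `E` fails to be positive on some chord, then a suitable continuous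
family of chords, followed from there towards the inside of the trapezoid, has a last member on which
`E` takes a given level `c ∈ (0, κ)` or less, and on that member `E` has a local minimum of value `c`
(`lt_of_forall_not_isLocalMin`). For a generic `c` the heights of such minima are roots of a nonzero
resultant whose degree depends only on `n` (`exists_level_eliminant`). So cutting at boundedly many
heights makes all chords good (`exists_finset_chord_pos`), and the estimates for the pieces add up.

The frequency `λ` is absorbed into `S` and `μ`.
-/

noncomputable section

namespace TrilinearVdC

open scoped ENNReal ComplexConjugate

/-! ### Calculus of real polynomials in two variables -/

lemma pderiv_pderiv_comm (i j : Fin 2) (P : MvPolynomial (Fin 2) ℝ) :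
    MvPolynomial.pderiv i (MvPolynomial.pderiv j P) =
      MvPolynomial.pderiv j (MvPolynomial.pderiv i P) := by
  have h : ⁅(MvPolynomial.pderiv i : Derivation ℝ (MvPolynomial (Fin 2) ℝ) (MvPolynomial (Fin 2) ℝ)),
      (MvPolynomial.pderiv j :
        Derivation ℝ (MvPolynomial (Fin 2) ℝ) (MvPolynomial (Fin 2) ℝ))⁆ = 0 := by
    apply MvPolynomial.derivation_ext
    intro k
    rw [Derivation.commutator_apply]
    simp only [MvPolynomial.pderiv_X, Derivation.zero_apply]
    simp only [Pi.single_apply, apply_ite, map_zero, Derivation.map_one_eq_zero]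
    simp
  have h2 := congrArg (fun D => D P) h
  simp only [Derivation.commutator_apply, Derivation.zero_apply] at h2
  exact sub_eq_zero.mp h2

lemma totalDegree_pderiv_le (i : Fin 2) (P : MvPolynomial (Fin 2) ℝ) :
    (MvPolynomial.pderiv i P).totalDegree ≤ P.totalDegree := by
  conv_lhs => rw [P.as_sum, map_sum]
  refine (MvPolynomial.totalDegree_finsetSum _ _).trans (Finset.sup_le fun s hs => ?_)
  rw [MvPolynomial.pderiv_monomial]
  refine (MvPolynomial.totalDegree_monomial_le _ _).trans ?_
  refine le_trans ?_ (MvPolynomial.le_totalDegree hs)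
  exact Finsupp.degree_mono (tsub_le_self)

lemma totalDegree_mixedH_le (S : MvPolynomial (Fin 2) ℝ) :
    (mixedH S).totalDegree ≤ S.totalDegree := by
  unfold mixedH
  refine (totalDegree_pderiv_le _ _).trans ((totalDegree_pderiv_le _ _).trans ?_)
  refine (MvPolynomial.totalDegree_sub _ _).trans ?_
  exact max_le (totalDegree_pderiv_le _ _) (totalDegree_pderiv_le _ _)

@[simp] lemma evalXY_sub (P Q : MvPolynomial (Fin 2) ℝ) (x y : ℝ) :
    evalXY (P - Q) x y = evalXY P x y - evalXY Q x y := by simp [evalXY]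

@[simp] lemma evalXY_mul (P Q : MvPolynomial (Fin 2) ℝ) (x y : ℝ) :
    evalXY (P * Q) x y = evalXY P x y * evalXY Q x y := by simp [evalXY]

@[simp] lemma evalXY_C (c : ℝ) (x y : ℝ) : evalXY (MvPolynomial.C c) x y = c := by simp [evalXY]

lemma hasDerivAt_evalXY (P : MvPolynomial (Fin 2) ℝ) {x y : ℝ → ℝ} {x' y' s : ℝ}
    (hx : HasDerivAt x x' s) (hy : HasDerivAt y y' s) :
    HasDerivAt (fun r => evalXY P (x r) (y r))
      (evalXY (MvPolynomial.pderiv 0 P) (x s) (y s) * x' +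
        evalXY (MvPolynomial.pderiv 1 P) (x s) (y s) * y') s := by
  unfold evalXY
  induction P using MvPolynomial.induction_on with
  | C a => simpa using hasDerivAt_const s a
  | add p q hp hq =>
    simp only [map_add]
    exact (hp.add hq).congr_deriv (by ring)
  | mul_X p i hp =>
    fin_cases i
    · simp only [map_mul, MvPolynomial.eval_X, Derivation.leibniz, Fin.zero_eta,
        Matrix.cons_val_zero, smul_eq_mul, map_add, MvPolynomial.pderiv_X_self,
        MvPolynomial.pderiv_X_of_ne (show (0 : Fin 2) ≠ 1 by decide)]
      refine (hp.mul hx).congr_deriv ?_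
      simp; ring
    · simp only [map_mul, MvPolynomial.eval_X, Derivation.leibniz, Fin.mk_one,
        Matrix.cons_val_one, smul_eq_mul, map_add, MvPolynomial.pderiv_X_self,
        MvPolynomial.pderiv_X_of_ne (show (1 : Fin 2) ≠ 0 by decide)]
      refine (hp.mul hy).congr_deriv ?_
      simp; ring

lemma continuous_evalXY {X : Type*} [TopologicalSpace X] {f g : X → ℝ} (hf : Continuous f)
    (hg : Continuous g) (P : MvPolynomial (Fin 2) ℝ) :
    Continuous fun x => evalXY P (f x) (g x) := by
  unfold evalXY
  have : Continuous fun x => (![f x, g x] : Fin 2 → ℝ) := by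
    refine continuous_pi fun i => ?_
    fin_cases i
    · exact hf
    · exact hg
  exact (MvPolynomial.continuous_eval P).comp this

/-- The restriction `X ↦ P(X + c, d)` of a polynomial in two variables to a horizontal line. -/
def sliceX (P : MvPolynomial (Fin 2) ℝ) (c d : ℝ) : Polynomial ℝ :=
  MvPolynomial.aeval ![Polynomial.X + Polynomial.C c, Polynomial.C d] P

lemma eval_sliceX (P : MvPolynomial (Fin 2) ℝ) (c d x : ℝ) :
    (sliceX P c d).eval x = evalXY P (x + c) d := by
  unfold sliceX evalXY
  induction P using MvPolynomial.induction_on with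
  | C a => simp
  | add p q hp hq => simp [hp, hq]
  | mul_X p i hp =>
    rw [map_mul, Polynomial.eval_mul, hp, map_mul]
    congr 1
    fin_cases i <;> simp

lemma natDegree_sliceX_le (P : MvPolynomial (Fin 2) ℝ) (c d : ℝ) :
    (sliceX P c d).natDegree ≤ P.totalDegree := by
  have := MvPolynomial.aeval_natDegree_le P le_rfl
    ![Polynomial.X + Polynomial.C c, Polynomial.C d] (n := 1) (by
      intro i
      fin_cases i
      · simp
      · simp)
  simpa [sliceX] using this

/-- The mean value theorem for the mixed second difference of `∂ₓS` over the parallelogram spanned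
by a vertical and an antidiagonal side. -/
lemma exists_second_difference_eq (S : MvPolynomial (Fin 2) ℝ) (x y y' t : ℝ) :
    ∃ ξ ∈ Set.uIcc y y', ∃ η ∈ Set.uIcc 0 t,
      |evalXY (MvPolynomial.pderiv 0 S) x y - evalXY (MvPolynomial.pderiv 0 S) (x + t) (y - t) -
        (evalXY (MvPolynomial.pderiv 0 S) x y' -
          evalXY (MvPolynomial.pderiv 0 S) (x + t) (y' - t))| =
      |y - y'| * |t| * |evalXY (mixedH S) (x + η) (ξ - η)| := by
  have mvt : ∀ (f f' : ℝ → ℝ) (a b : ℝ), (∀ r, HasDerivAt f (f' r) r) →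
      ∃ ξ ∈ Set.uIcc a b, f a - f b = (a - b) * f' ξ := by
    intro f f' a b hf
    have key : ∀ a b : ℝ, a < b → ∃ ξ ∈ Set.Icc a b, f b - f a = (b - a) * f' ξ := by
      intro a b hab
      obtain ⟨ξ, hξ, h⟩ := exists_hasDerivAt_eq_slope f f' hab
        (fun r _ => (hf r).continuousAt.continuousWithinAt) (fun r _ => hf r)
      refine ⟨ξ, Set.Ioo_subset_Icc_self hξ, ?_⟩
      rw [h]
      field_simp [(sub_pos.mpr hab).ne']
    rcases lt_trichotomy a b with h | h | h
    · obtain ⟨ξ, hξ, e⟩ := key a b h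
      exact ⟨ξ, by rwa [Set.uIcc_of_le h.le], by linarith⟩
    · subst h
      exact ⟨a, by simp, by simp⟩
    · obtain ⟨ξ, hξ, e⟩ := key b a h
      exact ⟨ξ, by rwa [Set.uIcc_of_ge h.le], by linarith⟩
  set P := MvPolynomial.pderiv 0 S with hP
  obtain ⟨ξ, hξ, e⟩ := mvt (fun r => evalXY P x r - evalXY P (x + t) (r - t))
    (fun r => evalXY (MvPolynomial.pderiv 1 P) x r -
      evalXY (MvPolynomial.pderiv 1 P) (x + t) (r - t)) y y' (by
      intro r
      have h1 := hasDerivAt_evalXY P (hasDerivAt_const r x) (hasDerivAt_id r)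
      have h2 := hasDerivAt_evalXY P (hasDerivAt_const r (x + t)) ((hasDerivAt_id r).sub_const t)
      exact (h1.sub h2).congr_deriv (by simp))
  have hH : mixedH S = MvPolynomial.pderiv 0 (MvPolynomial.pderiv 1 P) -
      MvPolynomial.pderiv 1 (MvPolynomial.pderiv 1 P) := by
    simp only [mixedH, map_sub, hP]
    congr 1
    rw [pderiv_pderiv_comm 0 1 (MvPolynomial.pderiv 1 S), pderiv_pderiv_comm 0 1 S]
  obtain ⟨η, hη, e2⟩ := mvt (fun r => evalXY (MvPolynomial.pderiv 1 P) (x + r) (ξ - r))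
    (fun r => evalXY (mixedH S) (x + r) (ξ - r)) 0 t (by
      intro r
      have h1 := hasDerivAt_evalXY (MvPolynomial.pderiv 1 P) ((hasDerivAt_id r).const_add x)
        ((hasDerivAt_id r).const_sub ξ)
      refine h1.congr_deriv ?_
      rw [hH, evalXY_sub]
      simp; ring)
  refine ⟨ξ, hξ, η, hη, ?_⟩
  simp only [add_zero, sub_zero] at e2
  rw [e, e2, zero_sub, abs_mul, abs_mul, abs_neg, mul_assoc]

/-! ### Markov's inequality -/

/-- **Markov's inequality** on an interval, for derivatives of all orders and with an unspecified
constant. It follows from the endpoint case, applied on the longer of the two parts into which the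
point divides the interval. -/
lemma exists_markov (n k : ℕ) : ∃ C : ℝ, 0 ≤ C ∧ ∀ (P : Polynomial ℝ), P.natDegree ≤ n →
    ∀ (p q U : ℝ), p < q → 0 < U → (∀ x ∈ Set.Icc p q, |P.eval x| ≤ U) →
    ∀ x ∈ Set.Icc p q, |(Polynomial.derivative^[k] P).eval x| ≤ C * U / (q - p) ^ k := by
  set T := (Polynomial.derivative^[k] (Polynomial.Chebyshev.T ℝ n)).eval 1 with hT
  refine ⟨|T| * 4 ^ k, by positivity, ?_⟩
  intro P hP p q U hpq hU hb x hx
  -- the affine map `z ↦ r z + (x - r)` sends `1` to `x` and `[-1, 1]` into `[p, q]`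
  obtain ⟨r, hr, hmap⟩ : ∃ r : ℝ, (q - p) / 4 ≤ |r| ∧
      ∀ z ∈ Set.Icc (-1 : ℝ) 1, r * z + (x - r) ∈ Set.Icc p q := by
    have hx1 := hx.1
    have hx2 := hx.2
    rcases le_total ((q - p) / 2) (x - p) with h | h
    · refine ⟨(x - p) / 2, by rw [abs_of_nonneg (by linarith)]; linarith, ?_⟩
      rintro z ⟨h1, h2⟩
      constructor <;> nlinarith
    · refine ⟨(x - q) / 2, by rw [abs_of_nonpos (by linarith)]; linarith, ?_⟩
      rintro z ⟨h1, h2⟩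
      constructor <;> nlinarith
  have hqp : 0 < q - p := sub_pos.mpr hpq
  have hr0 : 0 < |r| := lt_of_lt_of_le (by positivity) hr
  have hder : ∀ Q : Polynomial ℝ, Polynomial.derivative^[k]
      (Q.comp (Polynomial.C r * Polynomial.X + Polynomial.C (x - r))) =
      Polynomial.C (r ^ k) * (Polynomial.derivative^[k] Q).comp
        (Polynomial.C r * Polynomial.X + Polynomial.C (x - r)) := by
    intro Q
    clear hT T
    induction k with
    | zero => simp
    | succ j ih =>
      rw [Function.iterate_succ_apply', ih, Function.iterate_succ_apply']
      simp only [Polynomial.derivative_mul, Polynomial.derivative_C, zero_mul, zero_add,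
        Polynomial.derivative_comp, Polynomial.derivative_add, Polynomial.derivative_X, mul_one,
        add_zero, pow_succ, map_mul]
      ring
  have main : ∀ c : ℝ, |c| = U⁻¹ →
      c * (r ^ k * (Polynomial.derivative^[k] P).eval x) ≤ T := by
    intro c hc
    have h1 := Polynomial.Chebyshev.eval_iterate_derivative_le_of_forall_abs_le_one (n := n)
      (P := Polynomial.C c * P.comp (Polynomial.C r * Polynomial.X + Polynomial.C (x - r)))
      (k := k) (x := 1) le_rfl (by
        refine Polynomial.degree_le_of_natDegree_le ?_
        refine (Polynomial.natDegree_C_mul_le _ _).trans ?_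
        refine Polynomial.natDegree_comp_le.trans ?_
        have : (Polynomial.C r * Polynomial.X + Polynomial.C (x - r)).natDegree ≤ 1 :=
          Polynomial.natDegree_linear_le
        calc _ ≤ P.natDegree * 1 := Nat.mul_le_mul_left _ this
          _ ≤ n := by simpa using hP) (by
        intro z hz
        simp only [Polynomial.eval_mul, Polynomial.eval_C, Polynomial.eval_comp,
          Polynomial.eval_add, Polynomial.eval_X]
        rw [abs_mul, hc]
        calc U⁻¹ * |P.eval (r * z + (x - r))| ≤ U⁻¹ * U := by
              gcongr; exact hb _ (hmap z hz)
          _ = 1 := inv_mul_cancel₀ hU.ne')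
    rw [Polynomial.iterate_derivative_C_mul, hder] at h1
    simpa using h1
  have h1 := main U⁻¹ (abs_of_pos (by positivity))
  have h2 := main (-U⁻¹) (by rw [abs_neg]; exact abs_of_pos (by positivity))
  have h3 : U⁻¹ * (|r| ^ k * |(Polynomial.derivative^[k] P).eval x|) ≤ |T| := by
    rw [← abs_pow, ← abs_mul, ← abs_of_pos (inv_pos.mpr hU), ← abs_mul]
    exact abs_le_abs h1 (by linarith)
  rw [le_div_iff₀ (by positivity)]
  have h4 : ((q - p) / 4) ^ k ≤ |r| ^ k := by gcongr
  rw [div_pow] at h4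
  have h5 : (q - p) ^ k ≤ |r| ^ k * 4 ^ k := by
    rwa [div_le_iff₀ (by positivity)] at h4
  rw [inv_mul_le_iff₀ hU] at h3
  calc |(Polynomial.derivative^[k] P).eval x| * (q - p) ^ k
      ≤ |(Polynomial.derivative^[k] P).eval x| * (|r| ^ k * 4 ^ k) := by gcongr
    _ = (|r| ^ k * |(Polynomial.derivative^[k] P).eval x|) * 4 ^ k := by ring
    _ ≤ (U * |T|) * 4 ^ k := by gcongr
    _ = |T| * 4 ^ k * U := by ring

/-! ### Elimination -/

/-- A polynomial in two variables as a polynomial in `x` whose coefficients are polynomials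
in `y`. -/
def toBivariate (P : MvPolynomial (Fin 2) ℝ) : Polynomial (Polynomial ℝ) :=
  MvPolynomial.aeval ![Polynomial.X, Polynomial.C Polynomial.X] P

lemma eval_map_toBivariate (P : MvPolynomial (Fin 2) ℝ) (x y : ℝ) :
    ((toBivariate P).map (Polynomial.evalRingHom y)).eval x = evalXY P x y := by
  unfold toBivariate evalXY
  induction P using MvPolynomial.induction_on with
  | C a =>
    simp [Polynomial.algebraMap_apply]
  | add p q hp hq => simp only [map_add, Polynomial.map_add, Polynomial.eval_add, hp, hq]
  | mul_X p i hp =>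
    rw [map_mul, Polynomial.map_mul, Polynomial.eval_mul, hp, map_mul]
    congr 1
    fin_cases i <;> simp

lemma toBivariate_eq_sum (P : MvPolynomial (Fin 2) ℝ) :
    toBivariate P = ∑ s ∈ P.support,
      Polynomial.monomial (s 0) (Polynomial.monomial (s 1) (P.coeff s)) := by
  conv_lhs => rw [P.as_sum]
  unfold toBivariate
  rw [map_sum]
  refine Finset.sum_congr rfl fun s _ => ?_
  rw [MvPolynomial.aeval_monomial, Finsupp.prod_fintype _ _ (by simp)]
  simp only [Fin.prod_univ_two, Matrix.cons_val_zero, Matrix.cons_val_one,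
    ← Polynomial.C_mul_X_pow_eq_monomial, map_mul, map_pow, Polynomial.algebraMap_apply]
  simp only [Algebra.algebraMap_self, RingHom.id_apply]
  ring

lemma sum_two_le_totalDegree {P : MvPolynomial (Fin 2) ℝ} {s : Fin 2 →₀ ℕ} (hs : s ∈ P.support) :
    s 0 + s 1 ≤ P.totalDegree := by
  have := MvPolynomial.le_totalDegree hs
  rwa [Finsupp.sum_fintype _ _ (by simp), Fin.sum_univ_two] at this

lemma natDegree_toBivariate_le (P : MvPolynomial (Fin 2) ℝ) :
    (toBivariate P).natDegree ≤ P.totalDegree := by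
  rw [toBivariate_eq_sum]
  refine Polynomial.natDegree_sum_le_of_forall_le _ _ fun s hs => ?_
  exact (Polynomial.natDegree_monomial_le _).trans (by have := sum_two_le_totalDegree hs; omega)

lemma natDegree_coeff_toBivariate_le (P : MvPolynomial (Fin 2) ℝ) (i : ℕ) :
    ((toBivariate P).coeff i).natDegree ≤ P.totalDegree := by
  rw [toBivariate_eq_sum, Polynomial.finsetSum_coeff]
  refine Polynomial.natDegree_sum_le_of_forall_le _ _ fun s hs => ?_
  rw [Polynomial.coeff_monomial]
  split_ifs
  · exact (Polynomial.natDegree_monomial_le _).trans (by have := sum_two_le_totalDegree hs; omega)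
  · simp

lemma natDegree_resultant_le {f g : Polynomial (Polynomial ℝ)} {m : ℕ} (d e : ℕ)
    (hf : ∀ i, (f.coeff i).natDegree ≤ m) (hg : ∀ i, (g.coeff i).natDegree ≤ m) :
    (Polynomial.resultant f g d e).natDegree ≤ (d + e) * m := by
  unfold Polynomial.resultant
  rw [Matrix.det_apply]
  refine Polynomial.natDegree_sum_le_of_forall_le _ _ fun σ _ => ?_
  refine (Polynomial.natDegree_smul_le _ _).trans ?_
  refine (Polynomial.natDegree_prod_le _ _).trans ?_
  calc _ ≤ ∑ _i : Fin (d + e), m := by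
        refine Finset.sum_le_sum fun i _ => ?_
        unfold Polynomial.sylvester
        rw [Matrix.of_apply]
        refine Fin.addCases (fun j => ?_) (fun j => ?_) i
        · rw [Fin.addCases_left]
          split_ifs
          · exact hg _
          · simp
        · rw [Fin.addCases_right]
          split_ifs
          · exact hf _
          · simp
    _ = (d + e) * m := by simp

/-- For some level `c ∈ (0, κ)`, the `y`-coordinates of the common zeros of `Q` and `E - c` are
among the roots of a nonzero polynomial of bounded degree: the resultant of `Q` and `E - c` with
respect to `x`. It can vanish identically for finitely many `c` only. -/
lemma exists_level_eliminant {m : ℕ} {E Q : MvPolynomial (Fin 2) ℝ} (hE : E.totalDegree ≤ m)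
    (hQ : Q.totalDegree ≤ m) (hQ0 : toBivariate Q ≠ 0) {κ : ℝ} (hκ : 0 < κ) :
    ∃ c ∈ Set.Ioo 0 κ, ∃ r : Polynomial ℝ, r ≠ 0 ∧ r.natDegree ≤ (2 * m + 1) * m ∧
      ∀ x y, evalXY Q x y = 0 → evalXY E x y = c → r.eval y = 0 := by
  set q := toBivariate Q with hq
  set e := toBivariate E with he
  have hqd : q.natDegree ≤ m := (natDegree_toBivariate_le Q).trans hQ
  have hed : e.natDegree ≤ m := (natDegree_toBivariate_le E).trans hE
  obtain ⟨y₀, hy₀⟩ : ∃ y₀ : ℝ, q.leadingCoeff.eval y₀ ≠ 0 := by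
    by_contra! h
    exact hQ0 (Polynomial.leadingCoeff_eq_zero.mp (Polynomial.funext (by simpa using h)))
  -- specialize at a height `y₀` that keeps the degree of `Q` in `x`
  let φ : Polynomial ℝ →+* ℂ := Complex.ofRealHom.comp (Polynomial.evalRingHom y₀)
  have hφ : φ q.leadingCoeff ≠ 0 := by simpa [φ] using hy₀
  have hq' : (q.map φ).natDegree = q.natDegree :=
    Polynomial.natDegree_map_of_leadingCoeff_ne_zero φ hφ
  -- choose a level that is not a value of `E(·, y₀)` at a complex zero of `Q(·, y₀)`
  obtain ⟨c, hc, hcz⟩ : ∃ c ∈ Set.Ioo 0 κ, (c : ℂ) ∉ ((q.map φ).roots.map (e.map φ).eval) := by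
    have hfin : ((fun c : ℝ => (c : ℂ)) ⁻¹'
        (((q.map φ).roots.map (e.map φ).eval).toFinset : Set ℂ)).Finite :=
      (Finset.finite_toSet _).preimage Complex.ofReal_injective.injOn
    obtain ⟨c, hc, hcn⟩ := (Set.Ioo_infinite hκ).exists_notMem_finite hfin
    exact ⟨c, hc, by simpa using hcn⟩
  set g := e - Polynomial.C (Polynomial.C c) with hg
  -- the degree bound `m + 1` for `g`, rather than `m`, keeps it positive
  have hgd : g.natDegree ≤ m + 1 := by
    refine (Polynomial.natDegree_sub_le _ _).trans ?_
    simp; omega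
  refine ⟨c, hc, Polynomial.resultant q g q.natDegree (m + 1), ?_, ?_, ?_⟩
  · intro h0
    have h1 := Polynomial.resultant_map_map q g q.natDegree (m + 1) φ
    rw [h0, map_zero, ← hq', Polynomial.resultant_eq_prod_eval _ _ _
      (Polynomial.natDegree_map_le.trans hgd) (IsAlgClosed.splits _)] at h1
    rcases mul_eq_zero.mp h1 with h2 | h2
    · rw [Polynomial.leadingCoeff_map_of_leadingCoeff_ne_zero φ hφ] at h2
      exact hφ (pow_eq_zero_iff (by omega) |>.mp h2)
    · rw [Multiset.prod_eq_zero_iff, Multiset.mem_map] at h2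
      obtain ⟨z, hz, hz2⟩ := h2
      refine hcz (Multiset.mem_map.mpr ⟨z, hz, ?_⟩)
      rw [hg, Polynomial.map_sub, Polynomial.eval_sub] at hz2
      simpa [φ, sub_eq_zero] using hz2
  · refine (natDegree_resultant_le (m := m) _ _ ?_ ?_).trans ?_
    · exact fun i => (natDegree_coeff_toBivariate_le Q i).trans hQ
    · intro i
      rw [hg, Polynomial.coeff_sub]
      refine (Polynomial.natDegree_sub_le _ _).trans ?_
      refine max_le ((natDegree_coeff_toBivariate_le E i).trans hE) ?_
      rw [Polynomial.coeff_C]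
      split_ifs <;> simp
    · exact Nat.mul_le_mul_right _ (by omega)
  · intro x y hx hy
    obtain ⟨p, s, -, -, hps⟩ := Polynomial.exists_mul_add_mul_eq_C_resultant (m := q.natDegree)
      (n := m + 1) q g le_rfl hgd (Or.inr (by omega))
    have h1 := congrArg (fun P => (Polynomial.map (Polynomial.evalRingHom y) P).eval x) hps
    simp only [Polynomial.map_add, Polynomial.map_mul, Polynomial.eval_add, Polynomial.eval_mul,
      hg, Polynomial.map_sub, Polynomial.eval_sub, hq, he, eval_map_toBivariate, hx, hy] at h1
    simpa using h1.symm

/-! ### Chords of a curved trapezoid -/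

/-- If `e ≥ κ > c` along the graph of `m` over `[y₁, y₂]` and along the two horizontal segments that
join its ends to the line `u = u₀`, and if no restriction of `e` to a vertical line has a local
minimum of value `c`, then `e > c` on the segment `{u₀} × [y₁, y₂]`. -/
lemma lt_of_forall_not_isLocalMin_of_lt {e : ℝ → ℝ → ℝ} (he : Continuous fun p : ℝ × ℝ => e p.1 p.2)
    {m : ℝ → ℝ} {y₁ y₂ u₀ c : ℝ} (hm : ContinuousOn m (Set.Icc y₁ y₂))
    (h₁ : ∀ v ∈ Set.Icc u₀ (m y₁), c < e v y₁) (h₂ : ∀ v ∈ Set.Icc u₀ (m y₂), c < e v y₂)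
    (hme : ∀ y ∈ Set.Icc y₁ y₂, c < e (m y) y)
    (hcrit : ∀ u, ∀ y ∈ Set.Ioo y₁ y₂, e u y = c → ¬ IsLocalMin (e u) y)
    {y : ℝ} (hy : y ∈ Set.Icc y₁ y₂) (hmy : u₀ ≤ m y) : c < e u₀ y := by
  by_contra! hcon
  set Z : Set (ℝ × ℝ) := {p | p.2 ∈ Set.Icc y₁ y₂ ∧ u₀ ≤ p.1 ∧ p.1 ≤ m p.2 ∧ e p.1 p.2 ≤ c} with hZ
  -- a point of `Z` with the largest first coordinate gives a local minimum of value `c`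
  obtain ⟨U, hU⟩ : ∃ U, ∀ z ∈ Set.Icc y₁ y₂, m z ≤ U := by
    obtain ⟨U, hU⟩ := (isCompact_Icc.image_of_continuousOn hm).bddAbove
    exact ⟨U, fun z hz => hU ⟨z, hz, rfl⟩⟩
  have hK : IsCompact (Set.Icc u₀ U ×ˢ Set.Icc y₁ y₂) := isCompact_Icc.prod isCompact_Icc
  have hZsub : Z ⊆ Set.Icc u₀ U ×ˢ Set.Icc y₁ y₂ :=
    fun p hp => ⟨⟨hp.2.1, hp.2.2.1.trans (hU _ hp.1)⟩, hp.1⟩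
  have hmc : Continuous (Set.IccExtend (hy.1.trans hy.2) (Set.domRestrict (Set.Icc y₁ y₂) m)) :=
    (continuousOn_iff_continuous_domRestrict.mp hm).Icc_extend'
  have hme' : ∀ z ∈ Set.Icc y₁ y₂,
      Set.IccExtend (hy.1.trans hy.2) (Set.domRestrict (Set.Icc y₁ y₂) m) z = m z :=
    fun z hz => by rw [Set.IccExtend_of_mem _ _ hz]; rfl
  set m' := Set.IccExtend (hy.1.trans hy.2) (Set.domRestrict (Set.Icc y₁ y₂) m)
  have hZc : IsClosed Z := by
    have : Z = {p | p.2 ∈ Set.Icc y₁ y₂ ∧ u₀ ≤ p.1 ∧ p.1 ≤ m' p.2 ∧ e p.1 p.2 ≤ c} := by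
      ext p
      simp only [hZ, Set.mem_ofPred_eq]
      refine and_congr_right fun h => ?_
      rw [hme' _ h]
    rw [this]
    refine (isClosed_Icc.preimage continuous_snd).inter
      ((isClosed_le continuous_const continuous_fst).inter
      ((isClosed_le continuous_fst (hmc.comp continuous_snd)).inter
      (isClosed_le he continuous_const)))
  have hZne : Z.Nonempty := ⟨(u₀, y), hy, le_rfl, hmy, hcon⟩
  obtain ⟨⟨u, z⟩, hp, hmax⟩ := (hK.of_isClosed_subset hZc hZsub).exists_isMaxOn hZne
    continuous_fst.continuousOn
  obtain ⟨hz, hu0, hum, hec⟩ := hp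
  simp only at hz hu0 hum hec
  have hz1 : z ≠ y₁ := by
    rintro rfl
    exact absurd (h₁ u ⟨hu0, hum⟩) (not_lt.mpr hec)
  have hz2 : z ≠ y₂ := by
    rintro rfl
    exact absurd (h₂ u ⟨hu0, hum⟩) (not_lt.mpr hec)
  have hzo : z ∈ Set.Ioo y₁ y₂ := ⟨lt_of_le_of_ne hz.1 (Ne.symm hz1), lt_of_le_of_ne hz.2 hz2⟩
  have hum' : u < m' z := by
    rw [hme' z hz]
    refine lt_of_le_of_ne hum ?_
    rintro rfl
    exact absurd (hme z hz) (not_lt.mpr hec)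
  have hnear : ∀ᶠ w in nhds z, c ≤ e u w := by
    have h1 : ∀ᶠ w in nhds z, u < m' w := hmc.continuousAt.eventually (lt_mem_nhds hum')
    filter_upwards [h1, isOpen_Ioo.mem_nhds hzo] with w hw hwo
    have hlim : Filter.Tendsto (fun v => e v w) (nhdsWithin u (Set.Ioi u)) (nhds (e u w)) :=
      ((he.comp (Continuous.prodMk_left w)).tendsto u).mono_left nhdsWithin_le_nhds
    refine ge_of_tendsto hlim ?_
    filter_upwards [Ioo_mem_nhdsGT hw] with v hv
    by_contra! hlt
    have hwI : w ∈ Set.Icc y₁ y₂ := Set.Ioo_subset_Icc_self hwo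
    have hv2 : v ≤ m w := by rw [← hme' w hwI]; exact hv.2.le
    have := hmax (show (v, w) ∈ Z from ⟨hwI, hu0.trans hv.1.le, hv2, hlt.le⟩)
    exact absurd hv.1 (not_lt.mpr this)
  have heq : e u z = c := le_antisymm hec hnear.self_of_nhds
  refine hcrit u z hzo heq ?_
  filter_upwards [hnear] with w hw
  rw [heq]; exact hw

/-- Two-sided version of `lt_of_forall_not_isLocalMin_of_lt`. -/
lemma lt_of_forall_not_isLocalMin {e : ℝ → ℝ → ℝ} (he : Continuous fun p : ℝ × ℝ => e p.1 p.2)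
    {m : ℝ → ℝ} {y₁ y₂ u₀ c : ℝ} (hm : ContinuousOn m (Set.Icc y₁ y₂))
    (h₁ : ∀ v ∈ Set.uIcc u₀ (m y₁), c < e v y₁) (h₂ : ∀ v ∈ Set.uIcc u₀ (m y₂), c < e v y₂)
    (hme : ∀ y ∈ Set.Icc y₁ y₂, c < e (m y) y)
    (hcrit : ∀ u, ∀ y ∈ Set.Ioo y₁ y₂, e u y = c → ¬ IsLocalMin (e u) y)
    {y : ℝ} (hy : y ∈ Set.Icc y₁ y₂) : c < e u₀ y := by
  rcases le_total u₀ (m y) with h | h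
  · exact lt_of_forall_not_isLocalMin_of_lt he hm (fun v hv => h₁ v (Set.Icc_subset_uIcc hv))
      (fun v hv => h₂ v (Set.Icc_subset_uIcc hv)) hme hcrit hy h
  · have := lt_of_forall_not_isLocalMin_of_lt (e := fun u y => e (-u) y) (m := fun y => -m y)
      (u₀ := -u₀) (c := c) (he.comp (by fun_prop : Continuous fun p : ℝ × ℝ => (-p.1, p.2))) hm.neg
      (fun v hv => h₁ (-v) (Set.Icc_subset_uIcc' ⟨by linarith [hv.2], by linarith [hv.1]⟩))
      (fun v hv => h₂ (-v) (Set.Icc_subset_uIcc' ⟨by linarith [hv.2], by linarith [hv.1]⟩))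
      (by simpa using hme) (fun u z hz => hcrit (-u) z hz) hy (neg_le_neg h)
    simpa using this

/-- A bounded number of values of `y` splits a curved trapezoid on which `E ≥ κ > 0` into pieces
whose antidiagonal chords stay in `{E > 0}`. -/
lemma exists_finset_chord_pos {m : ℕ} {E : MvPolynomial (Fin 2) ℝ} (hE : E.totalDegree ≤ m)
    {κ : ℝ} (hκ : 0 < κ) {a b : ℝ} {α β : ℝ → ℝ} (hΩ : IsTrapezoidData a b α β)
    (hEκ : ∀ x, ∀ y ∈ Set.Ioo a b, x ∈ Set.Ioo (α y) (β y) → κ ≤ evalXY E x y) :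
    ∃ F : Finset ℝ, F.card ≤ (2 * m + 1) * m ∧ ∀ y₁ y₂ u : ℝ,
      (∀ z ∈ F, z ∉ Set.Icc y₁ y₂) → y₁ ∈ Set.Ioo a b → u - y₁ ∈ Set.Ioo (α y₁) (β y₁) →
      y₂ ∈ Set.Ioo a b → u - y₂ ∈ Set.Ioo (α y₂) (β y₂) →
      ∀ y ∈ Set.Icc y₁ y₂, 0 < evalXY E (u - y) y := by
  -- the derivative of `E` along antidiagonals
  set Q := MvPolynomial.pderiv 1 E - MvPolynomial.pderiv 0 E with hQ
  have hder : ∀ u y, HasDerivAt (fun r => evalXY E (u - r) r) (evalXY Q (u - y) y) y := by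
    intro u y
    refine (hasDerivAt_evalXY E ((hasDerivAt_id y).const_sub u) (hasDerivAt_id y)).congr_deriv ?_
    rw [hQ, evalXY_sub]
    simp; ring
  have hQd : Q.totalDegree ≤ m := by
    have h0 := (totalDegree_pderiv_le 0 E).trans hE
    have h1 := (totalDegree_pderiv_le 1 E).trans hE
    exact (MvPolynomial.totalDegree_sub _ _).trans (max_le h1 h0)
  clear_value Q
  by_cases hQ0 : toBivariate Q = 0
  · -- `E` is constant on every antidiagonal
    refine ⟨∅, by simp, ?_⟩
    intro y₁ y₂ u _ h1 h1' _ _ y _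
    have hz : ∀ x y, evalXY Q x y = 0 := by
      intro x y
      rw [← eval_map_toBivariate, hQ0]; simp
    have hconst := is_const_of_deriv_eq_zero (f := fun r => evalXY E (u - r) r)
      (fun y => (hder u y).differentiableAt) (fun y => by rw [(hder u y).deriv, hz])
    have h2 : evalXY E (u - y) y = evalXY E (u - y₁) y₁ := hconst y y₁
    rw [h2]
    exact hκ.trans_le (hEκ _ _ h1 h1')
  obtain ⟨c, ⟨hc0, hcκ⟩, r, hr0, hrd, hr⟩ := exists_level_eliminant hE (Q := Q) hQd hQ0 hκ
  refine ⟨r.roots.toFinset, ?_, ?_⟩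
  · exact (Multiset.toFinset_card_le _).trans ((Polynomial.card_roots' r).trans hrd)
  intro y₁ y₂ u hF h1 h1' h2 h2' y hy
  have hsub : Set.Icc y₁ y₂ ⊆ Set.Icc a b := Set.Icc_subset_Icc h1.1.le h2.2.le
  have hin : ∀ z ∈ Set.Icc y₁ y₂, z ∈ Set.Ioo a b :=
    fun z hz => ⟨h1.1.trans_le hz.1, hz.2.trans_lt h2.2⟩
  have hseg : ∀ y' ∈ Set.Ioo a b, u - y' ∈ Set.Ioo (α y') (β y') →
      ∀ v ∈ Set.uIcc u ((α y' + β y') / 2 + y'), c < evalXY E (v - y') y' := by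
    intro y' hy' ⟨h3, h4⟩ v hv
    refine hcκ.trans_le (hEκ _ _ hy' ?_)
    rw [Set.mem_uIcc] at hv
    rcases hv with hv | hv
    · constructor <;> linarith [hv.1, hv.2]
    · constructor <;> linarith [hv.1, hv.2]
  -- in the coordinates `(u, y)` with `u = x + y` antidiagonals are vertical, and the middle curve of
  -- the trapezoid is a graph over `[y₁, y₂]`
  set e : ℝ → ℝ → ℝ := fun u y => evalXY E (u - y) y with he
  have hec : Continuous fun p : ℝ × ℝ => e p.1 p.2 :=
    continuous_evalXY (continuous_fst.sub continuous_snd) continuous_snd E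
  have hmid : ContinuousOn (fun y => (α y + β y) / 2 + y) (Set.Icc y₁ y₂) :=
    (((hΩ.continuousOn_left.mono hsub).add (hΩ.continuousOn_right.mono hsub)).div_const
      2).add continuousOn_id
  have hme : ∀ z ∈ Set.Icc y₁ y₂, c < e ((α z + β z) / 2 + z) z := by
    intro z hz
    have h3 := hΩ.left_lt_right z (hin z hz)
    refine hcκ.trans_le (hEκ _ _ (hin z hz) ?_)
    constructor <;> linarith
  have hcrit : ∀ v, ∀ z ∈ Set.Ioo y₁ y₂, e v z = c → ¬ IsLocalMin (e v) z := by
    intro v z hz hvz hmin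
    have h3 := hmin.hasDerivAt_eq_zero (hder v z)
    refine hF z ?_ (Set.Ioo_subset_Icc_self hz)
    rw [Multiset.mem_toFinset, Polynomial.mem_roots hr0]
    exact hr _ _ h3 hvz
  exact hc0.trans (lt_of_forall_not_isLocalMin hec hmid (hseg y₁ h1 h1') (hseg y₂ h2 h2') hme hcrit hy)

/-! ### The oscillatory kernel -/

/-- `f` is twice continuously differentiable with derivatives `f₁` and `f₂`, and on `s` the `k`-th
derivative is at most `G / L ^ k` in norm: `G` is the size of `f` and `L` its length scale. -/
structure C2Bound (f f₁ f₂ : ℝ → ℂ) (G L : ℝ) (s : Set ℝ) : Prop where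
  deriv₁ : ∀ x, HasDerivAt f (f₁ x) x
  deriv₂ : ∀ x, HasDerivAt f₁ (f₂ x) x
  cont : Continuous f₂
  bound₀ : ∀ x ∈ s, ‖f x‖ ≤ G
  bound₁ : ∀ x ∈ s, ‖f₁ x‖ ≤ G / L
  bound₂ : ∀ x ∈ s, ‖f₂ x‖ ≤ G / L ^ 2

namespace C2Bound

variable {f f₁ f₂ g g₁ g₂ : ℝ → ℂ} {G G' L L' : ℝ} {s : Set ℝ}

lemma mul (hf : C2Bound f f₁ f₂ G L s) (hg : C2Bound g g₁ g₂ G' L s) (hG : 0 ≤ G) (hG' : 0 ≤ G')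
    (hL : 0 < L) :
    C2Bound (fun x => f x * g x) (fun x => f₁ x * g x + f x * g₁ x)
      (fun x => f₂ x * g x + f₁ x * g₁ x + (f₁ x * g₁ x + f x * g₂ x)) (4 * (G * G')) L s where
  deriv₁ x := (hf.deriv₁ x).mul (hg.deriv₁ x)
  deriv₂ x := ((hf.deriv₂ x).mul (hg.deriv₁ x)).add ((hf.deriv₁ x).mul (hg.deriv₂ x))
  cont := by
    have h1 : Continuous f := continuous_iff_continuousAt.mpr fun x => (hf.deriv₁ x).continuousAt
    have h2 : Continuous f₁ := continuous_iff_continuousAt.mpr fun x => (hf.deriv₂ x).continuousAt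
    have h3 : Continuous g := continuous_iff_continuousAt.mpr fun x => (hg.deriv₁ x).continuousAt
    have h4 : Continuous g₁ := continuous_iff_continuousAt.mpr fun x => (hg.deriv₂ x).continuousAt
    have h5 := hf.cont
    have h6 := hg.cont
    fun_prop
  bound₀ x hx := by
    rw [norm_mul]
    have := mul_le_mul (hf.bound₀ x hx) (hg.bound₀ x hx) (norm_nonneg _) hG
    nlinarith [mul_nonneg hG hG']
  bound₁ x hx := by
    have h1 := mul_le_mul (hf.bound₁ x hx) (hg.bound₀ x hx) (norm_nonneg _) (by positivity)
    have h2 := mul_le_mul (hf.bound₀ x hx) (hg.bound₁ x hx) (norm_nonneg _) hG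
    calc _ ≤ ‖f₁ x * g x‖ + ‖f x * g₁ x‖ := norm_add_le _ _
      _ ≤ G / L * G' + G * (G' / L) := by rw [norm_mul, norm_mul]; exact add_le_add h1 h2
      _ = 2 * (G * G') / L := by ring
      _ ≤ 4 * (G * G') / L := by gcongr; norm_num
  bound₂ x hx := by
    have h1 := mul_le_mul (hf.bound₂ x hx) (hg.bound₀ x hx) (norm_nonneg _) (by positivity)
    have h2 := mul_le_mul (hf.bound₁ x hx) (hg.bound₁ x hx) (norm_nonneg _) (by positivity)
    have h3 := mul_le_mul (hf.bound₀ x hx) (hg.bound₂ x hx) (norm_nonneg _) hG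
    calc _ ≤ ‖f₂ x‖ * ‖g x‖ + ‖f₁ x‖ * ‖g₁ x‖ + (‖f₁ x‖ * ‖g₁ x‖ + ‖f x‖ * ‖g₂ x‖) := by
          simp only [← norm_mul]
          exact (norm_add_le _ _).trans (add_le_add (norm_add_le _ _) (norm_add_le _ _))
      _ ≤ G / L ^ 2 * G' + G / L * (G' / L) + (G / L * (G' / L) + G * (G' / L ^ 2)) := by
          gcongr
      _ = 4 * (G * G') / L ^ 2 := by field_simp; ring

/-- A larger size and a shorter length scale give a weaker bound. -/
lemma weaken (hf : C2Bound f f₁ f₂ G L Set.univ) (hG : 0 ≤ G) (hGG : G ≤ G') (hL : 0 < L')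
    (hLL : L' ≤ L) : C2Bound f f₁ f₂ G' L' s where
  deriv₁ := hf.deriv₁
  deriv₂ := hf.deriv₂
  cont := hf.cont
  bound₀ x _ := (hf.bound₀ x trivial).trans hGG
  bound₁ x _ := (hf.bound₁ x trivial).trans (by have := hG.trans hGG; gcongr)
  bound₂ x _ := (hf.bound₂ x trivial).trans (by have := hG.trans hGG; gcongr)

/-- If `f` vanishes to second order at `p`, then it is small near `p`: on an interval of length
`L'` starting at `p` it has size `G (L' / L)²` and length scale `L'`. -/
lemma of_vanish_left (hf : C2Bound f f₁ f₂ G L Set.univ) {p q : ℝ} (hpq : p < q)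
    (hL : 0 < L) (h0 : f p = 0) (h1 : f₁ p = 0) :
    C2Bound f f₁ f₂ (G * ((q - p) / L) ^ 2) (q - p) (Set.Icc p q) := by
  have hqp : 0 < q - p := sub_pos.mpr hpq
  have hG : 0 ≤ G := (norm_nonneg _).trans (hf.bound₀ p trivial)
  have key : ∀ (u u' : ℝ → ℂ) (M : ℝ), 0 ≤ M → (∀ x, HasDerivAt u (u' x) x) → u p = 0 →
      (∀ x ∈ Set.Icc p q, ‖u' x‖ ≤ M) → ∀ x ∈ Set.Icc p q, ‖u x‖ ≤ M * (q - p) := by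
    intro u u' M hM hu hup hb x hx
    have := (convex_Icc p q).norm_image_sub_le_of_norm_hasDerivWithin_le
      (fun x _ => (hu x).hasDerivWithinAt) hb (Set.left_mem_Icc.mpr hpq.le) hx
    rw [hup, sub_zero, Real.norm_eq_abs, abs_of_nonneg (by linarith [hx.1])] at this
    exact this.trans (by gcongr; exact hx.2)
  have b1 := key f₁ f₂ (G / L ^ 2) (by positivity) hf.deriv₂ h1 fun x _ => hf.bound₂ x trivial
  have b0 := key f f₁ _ (by positivity) hf.deriv₁ h0 b1
  refine ⟨hf.deriv₁, hf.deriv₂, hf.cont, fun x hx => ?_, fun x hx => ?_, fun x hx => ?_⟩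
  · exact (b0 x hx).trans_eq (by ring)
  · exact (b1 x hx).trans_eq (by field_simp)
  · exact (hf.bound₂ x trivial).trans_eq (by field_simp)

end C2Bound

/-- **The van der Corput estimate of second order**: two integrations by parts, with Markov's
inequality for the derivatives of the polynomial `Φ'`. -/
lemma exists_norm_integral_exp_mul_le (n : ℕ) (A : ℝ) (hA : 0 < A) : ∃ C : ℝ, 0 < C ∧
    ∀ (D : Polynomial ℝ), D.natDegree ≤ n → ∀ (Φ : ℝ → ℝ), (∀ x, HasDerivAt Φ (D.eval x) x) →
    ∀ (p q m : ℝ), p < q → 0 < m → (∀ x ∈ Set.Icc p q, m ≤ |D.eval x| ∧ |D.eval x| ≤ A * m) →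
    ∀ (f f₁ f₂ : ℝ → ℂ) (G : ℝ), C2Bound f f₁ f₂ G (q - p) (Set.Icc p q) →
    f p = 0 → f q = 0 → f₁ p = 0 → f₁ q = 0 →
    ‖∫ x in p..q, Complex.exp (Complex.I * (Φ x : ℂ)) * f x‖ ≤
      C * G * (q - p) / ((q - p) * m) ^ 2 := by
  obtain ⟨c₁, hc₁, markov₁⟩ := exists_markov n 1
  obtain ⟨c₂, hc₂, markov₂⟩ := exists_markov n 2
  refine ⟨1 + 3 * (c₁ * A) + (3 * (c₁ * A) ^ 2 + c₂ * A), by positivity, ?_⟩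
  intro D hDn Φ hΦ p q m hpq hm hD f f₁ f₂ G hf hfp hfq hf1p hf1q
  set L := q - p with hL
  have hL0 : 0 < L := sub_pos.mpr hpq
  have hG : 0 ≤ G := (norm_nonneg _).trans (hf.bound₀ p (Set.left_mem_Icc.mpr hpq.le))
  set D₁ := Polynomial.derivative D with hD₁
  set D₂ := Polynomial.derivative D₁ with hD₂
  have hdD : ∀ x, HasDerivAt (fun x => ((D.eval x : ℝ) : ℂ)) ((D₁.eval x : ℝ) : ℂ) x :=
    fun x => (D.hasDerivAt x).ofReal_comp
  have hdD₁ : ∀ x, HasDerivAt (fun x => ((D₁.eval x : ℝ) : ℂ)) ((D₂.eval x : ℝ) : ℂ) x :=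
    fun x => (D₁.hasDerivAt x).ofReal_comp
  have b₁ : ∀ x ∈ Set.Icc p q, |D₁.eval x| ≤ c₁ * (A * m) / L := by
    intro x hx
    simpa using markov₁ D hDn p q (A * m) hpq (by positivity) (fun x hx => (hD x hx).2) x hx
  have b₂ : ∀ x ∈ Set.Icc p q, |D₂.eval x| ≤ c₂ * (A * m) / L ^ 2 := by
    intro x hx
    simpa using markov₂ D hDn p q (A * m) hpq (by positivity) (fun x hx => (hD x hx).2) x hx
  have hD0 : ∀ x ∈ Set.Icc p q, ((D.eval x : ℝ) : ℂ) ≠ 0 := by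
    intro x hx h
    have h1 := (hD x hx).1
    rw [Complex.ofReal_eq_zero] at h
    rw [h, abs_zero] at h1
    linarith
  -- `W` is what remains of `f` after two integrations by parts, with sign changed
  let W : ℝ → ℂ := fun x => f₂ x / D.eval x ^ 2 - 3 * (f₁ x * D₁.eval x / D.eval x ^ 3) +
    f x * (3 * D₁.eval x ^ 2 / D.eval x ^ 4 - D₂.eval x / D.eval x ^ 3)
  let V : ℝ → ℂ := fun x => Complex.exp (Complex.I * (Φ x : ℂ)) *
    (-Complex.I * f x / D.eval x + (f₁ x / D.eval x ^ 2 - f x * D₁.eval x / D.eval x ^ 3))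
  have hV : ∀ x ∈ Set.uIcc p q, HasDerivAt V
      (Complex.exp (Complex.I * (Φ x : ℂ)) * (f x + W x)) x := by
    intro x hx
    rw [Set.uIcc_of_le hpq.le] at hx
    have h0 := hD0 x hx
    have e := ((hΦ x).ofReal_comp.const_mul Complex.I).cexp
    have t1 := ((hf.deriv₁ x).const_mul (-Complex.I)).div (hdD x) h0
    have t2 := (hf.deriv₂ x).div ((hdD x).pow 2) (pow_ne_zero 2 h0)
    have t3 := ((hf.deriv₁ x).mul (hdD₁ x)).div ((hdD x).pow 3) (pow_ne_zero 3 h0)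
    refine (e.mul (t1.add (t2.sub t3))).congr_deriv ?_
    simp only [W, Pi.add_apply, Pi.sub_apply, Pi.div_apply, Pi.mul_apply, Pi.pow_apply]
    generalize Complex.exp (Complex.I * (Φ x : ℂ)) = ex
    generalize ((D.eval x : ℝ) : ℂ) = d at h0
    field_simp
    linear_combination (-(ex * d ^ 6) * f x) * Complex.I_sq
  have cf : Continuous f := continuous_iff_continuousAt.mpr fun x => (hf.deriv₁ x).continuousAt
  have cf₁ : Continuous f₁ := continuous_iff_continuousAt.mpr fun x => (hf.deriv₂ x).continuousAt
  have cf₂ := hf.cont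
  have cΦ : Continuous Φ := continuous_iff_continuousAt.mpr fun x => (hΦ x).continuousAt
  have ce : Continuous fun x => Complex.exp (Complex.I * (Φ x : ℂ)) := by fun_prop
  have cD : ∀ P : Polynomial ℝ, Continuous fun x => ((P.eval x : ℝ) : ℂ) :=
    fun P => Complex.continuous_ofReal.comp P.continuous
  have cW : ContinuousOn W (Set.uIcc p q) := by
    rw [Set.uIcc_of_le hpq.le]
    have d0 := (cD D).continuousOn (s := Set.Icc p q)
    have d1 := (cD D₁).continuousOn (s := Set.Icc p q)
    have d2 := (cD D₂).continuousOn (s := Set.Icc p q)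
    exact ((cf₂.continuousOn.div (d0.pow 2) fun x hx => pow_ne_zero _ (hD0 x hx)).sub
      (continuousOn_const.mul ((cf₁.continuousOn.mul d1).div (d0.pow 3)
        fun x hx => pow_ne_zero _ (hD0 x hx)))).add (cf.continuousOn.mul
      (((continuousOn_const.mul (d1.pow 2)).div (d0.pow 4) fun x hx => pow_ne_zero _ (hD0 x hx)).sub
      (d2.div (d0.pow 3) fun x hx => pow_ne_zero _ (hD0 x hx))))
  have i1 : IntervalIntegrable (fun x => Complex.exp (Complex.I * (Φ x : ℂ)) * f x) volume p q :=
    (ce.mul cf).intervalIntegrable _ _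
  have i2 : IntervalIntegrable (fun x => Complex.exp (Complex.I * (Φ x : ℂ)) * W x) volume p q :=
    (ce.continuousOn.mul cW).intervalIntegrable
  have ftc := intervalIntegral.integral_eq_sub_of_hasDerivAt hV (by
    simp only [mul_add]; exact i1.add i2)
  have hVp : V p = 0 := by simp [V, hfp, hf1p]
  have hVq : V q = 0 := by simp [V, hfq, hf1q]
  simp only [mul_add] at ftc
  rw [hVp, hVq, sub_zero, intervalIntegral.integral_add i1 i2] at ftc
  rw [eq_neg_of_add_eq_zero_left ftc, norm_neg]
  have hW : ∀ x ∈ Set.Icc p q, ‖W x‖ ≤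
      (1 + 3 * (c₁ * A) + (3 * (c₁ * A) ^ 2 + c₂ * A)) * G / (L * m) ^ 2 := by
    intro x hx
    have hd := (hD x hx).1
    have nD : ∀ P : Polynomial ℝ, ‖((P.eval x : ℝ) : ℂ)‖ = |P.eval x| := fun P => by
      rw [Complex.norm_real, Real.norm_eq_abs]
    have e1 : ‖f₂ x / D.eval x ^ 2‖ ≤ G / L ^ 2 / m ^ 2 := by
      rw [norm_div, norm_pow, nD]
      have := hf.bound₂ x hx
      gcongr
    have e2 : ‖f₁ x * D₁.eval x / D.eval x ^ 3‖ ≤ G / L * (c₁ * (A * m) / L) / m ^ 3 := by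
      rw [norm_div, norm_pow, nD, norm_mul, nD]
      have := hf.bound₁ x hx
      have := b₁ x hx
      gcongr
    have e3 : ‖(3 * D₁.eval x ^ 2 / D.eval x ^ 4 : ℂ)‖ ≤
        3 * (c₁ * (A * m) / L) ^ 2 / m ^ 4 := by
      rw [norm_div, norm_pow, nD, norm_mul, norm_pow, nD, RCLike.norm_ofNat]
      have := b₁ x hx
      gcongr
    have e4 : ‖(D₂.eval x / D.eval x ^ 3 : ℂ)‖ ≤ c₂ * (A * m) / L ^ 2 / m ^ 3 := by
      rw [norm_div, norm_pow, nD, nD]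
      have := b₂ x hx
      gcongr
    calc ‖W x‖ ≤ ‖f₂ x / D.eval x ^ 2‖ + ‖3 * (f₁ x * D₁.eval x / D.eval x ^ 3)‖ +
          ‖f x * (3 * D₁.eval x ^ 2 / D.eval x ^ 4 - D₂.eval x / D.eval x ^ 3)‖ :=
        (norm_add_le _ _).trans (add_le_add (norm_sub_le _ _) le_rfl)
      _ ≤ G / L ^ 2 / m ^ 2 + 3 * (G / L * (c₁ * (A * m) / L) / m ^ 3) +
          G * (3 * (c₁ * (A * m) / L) ^ 2 / m ^ 4 + c₂ * (A * m) / L ^ 2 / m ^ 3) := by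
        rw [norm_mul 3, norm_mul (f x), RCLike.norm_ofNat]
        have := hf.bound₀ x hx
        have e5 := (norm_sub_le (3 * D₁.eval x ^ 2 / D.eval x ^ 4 : ℂ)
          (D₂.eval x / D.eval x ^ 3 : ℂ)).trans (add_le_add e3 e4)
        gcongr
      _ = _ := by field_simp
  calc _ ≤ (1 + 3 * (c₁ * A) + (3 * (c₁ * A) ^ 2 + c₂ * A)) * G / (L * m) ^ 2 * |q - p| := by
        refine intervalIntegral.norm_integral_le_of_norm_le_const fun x hx => ?_
        rw [Set.uIoc_of_le hpq.le] at hx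
        rw [norm_mul, mul_comm Complex.I, Complex.norm_exp_ofReal_mul_I, one_mul]
        exact hW x (Set.Ioc_subset_Icc_self hx)
    _ = _ := by rw [abs_of_pos hL0]; ring

lemma eq_zero_of_hasDerivAt_of_forall_le {f : ℝ → ℂ} {d : ℂ} {p : ℝ} (h : HasDerivAt f d p)
    (h0 : ∀ x ≤ p, f x = 0) : d = 0 := by
  have h1 : HasDerivWithinAt f 0 (Set.Iic p) p :=
    (hasDerivWithinAt_const p _ (0 : ℂ)).congr (fun x hx => h0 x hx) (h0 p le_rfl)
  exact (uniqueDiffWithinAt_Iic p).eq_deriv _ h.hasDerivWithinAt h1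

lemma eq_zero_of_hasDerivAt_of_forall_ge {f : ℝ → ℂ} {d : ℂ} {p : ℝ} (h : HasDerivAt f d p)
    (h0 : ∀ x, p ≤ x → f x = 0) : d = 0 := by
  have h1 : HasDerivWithinAt f 0 (Set.Ici p) p :=
    (hasDerivWithinAt_const p _ (0 : ℂ)).congr (fun x hx => h0 x hx) (h0 p le_rfl)
  exact (uniqueDiffWithinAt_Ici p).eq_deriv _ h.hasDerivWithinAt h1

/-- The oscillatory kernel. The amplitude is a product of four functions, each adapted to an
interval; the integral is controlled by the length `ℓ` of the shortest interval, even though the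
intersection of the four may be much shorter. This is because one of the factors vanishes to second
order at the left end of the intersection, which makes the amplitude small when the intersection is
short. -/
lemma exists_norm_kernel_le (n : ℕ) (A B : ℝ) (hA : 0 < A) (hB : 0 < B) : ∃ C : ℝ, 0 < C ∧
    ∀ (D : Polynomial ℝ), D.natDegree ≤ n → ∀ (Φ : ℝ → ℝ), (∀ x, HasDerivAt Φ (D.eval x) x) →
    ∀ (f f₁ f₂ : Fin 4 → ℝ → ℂ) (l r : Fin 4 → ℝ), (∀ i, l i < r i) →
    (∀ i, C2Bound (f i) (f₁ i) (f₂ i) B (r i - l i) Set.univ) →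
    (∀ i, ∀ x ∉ Set.Ioo (l i) (r i), f i x = 0) →
    ∀ m : ℝ, 0 ≤ m →
    (∀ x, (∀ i, x ∈ Set.Ioo (l i) (r i)) → m ≤ |D.eval x| ∧ |D.eval x| ≤ A * m) →
    ‖∫ x, Complex.exp (Complex.I * (Φ x : ℂ)) * (f 0 x * f 1 x * (f 2 x * f 3 x))‖ ≤
      C * ∑ i, (r i - l i) / (1 + ((r i - l i) * m) ^ 2) := by
  obtain ⟨C, hC, hosc⟩ := exists_norm_integral_exp_mul_le n A hA
  refine ⟨2 * ((1 + C * 64) * B ^ 4), by positivity, ?_⟩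
  intro D hDn Φ hΦ f f₁ f₂ l r hlr hf hsupp m hm hD
  have hpos : ∀ i, 0 < r i - l i := fun i => sub_pos.mpr (hlr i)
  -- `[p, q]` is the intersection of the four intervals, and the `j`-th of them is the shortest
  obtain ⟨ip, hip⟩ := Finite.exists_max l
  obtain ⟨iq, hiq⟩ := Finite.exists_min r
  obtain ⟨j, hj⟩ := Finite.exists_min fun i => r i - l i
  set p := l ip with hp
  set q := r iq with hq
  set ℓ := r j - l j with hℓ
  have hℓ0 : 0 < ℓ := hpos j
  -- only the term of the shortest interval is needed; the sum avoids singling it out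
  have hsum : ℓ / (1 + (ℓ * m) ^ 2) ≤ ∑ i, (r i - l i) / (1 + ((r i - l i) * m) ^ 2) :=
    Finset.single_le_sum (f := fun i => (r i - l i) / (1 + ((r i - l i) * m) ^ 2))
      (fun i _ => by have := (hpos i).le; positivity) (Finset.mem_univ j)
  refine le_trans ?_ (mul_le_mul_of_nonneg_left hsum (by positivity))
  set Ψ : ℝ → ℂ := fun x => f 0 x * f 1 x * (f 2 x * f 3 x) with hΨ
  change ‖∫ x, Complex.exp (Complex.I * (Φ x : ℂ)) * Ψ x‖ ≤ _
  have hΨ0 : ∀ x i, f i x = 0 → Ψ x = 0 := by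
    intro x i hx
    show f 0 x * f 1 x * (f 2 x * f 3 x) = 0
    fin_cases i
    · rw [show f 0 x = 0 from hx]; ring
    · rw [show f 1 x = 0 from hx]; ring
    · rw [show f 2 x = 0 from hx]; ring
    · rw [show f 3 x = 0 from hx]; ring
  have hΨp : ∀ x ≤ p, Ψ x = 0 := fun x hx => hΨ0 x ip (hsupp ip x fun h => absurd h.1 (not_lt.mpr hx))
  have hΨq : ∀ x, q ≤ x → Ψ x = 0 :=
    fun x hx => hΨ0 x iq (hsupp iq x fun h => absurd h.2 (not_lt.mpr hx))
  rcases le_or_gt q p with hqp | hpq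
  · have : ∀ x, Complex.exp (Complex.I * (Φ x : ℂ)) * Ψ x = 0 := by
      intro x
      rcases le_total x p with h | h
      · rw [hΨp x h, mul_zero]
      · rw [hΨq x (hqp.trans h), mul_zero]
    rw [integral_congr_ae (Filter.Eventually.of_forall this), integral_zero, norm_zero]
    positivity
  have hint : ∫ x, Complex.exp (Complex.I * (Φ x : ℂ)) * Ψ x =
      ∫ x in p..q, Complex.exp (Complex.I * (Φ x : ℂ)) * Ψ x := by
    rw [intervalIntegral.integral_of_le hpq.le]
    refine (setIntegral_eq_integral_of_forall_compl_eq_zero fun x hx => ?_).symm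
    rw [Set.mem_Ioc, not_and_or, not_lt, not_le] at hx
    rcases hx with h | h
    · rw [hΨp x h, mul_zero]
    · rw [hΨq x h.le, mul_zero]
  rw [hint]
  set L := q - p with hL
  have hL0 : 0 < L := sub_pos.mpr hpq
  have hLi : ∀ i, L ≤ r i - l i := fun i => by linarith [hip i, hiq i]
  have hLℓ : L ≤ ℓ := hLi j
  have htriv : ‖∫ x in p..q, Complex.exp (Complex.I * (Φ x : ℂ)) * Ψ x‖ ≤ B ^ 4 * ℓ := by
    calc _ ≤ B ^ 4 * |q - p| := by
          refine intervalIntegral.norm_integral_le_of_norm_le_const fun x _ => ?_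
          rw [norm_mul, mul_comm Complex.I, Complex.norm_exp_ofReal_mul_I, one_mul, hΨ]
          simp only [norm_mul]
          have hb := fun i => (hf i).bound₀ x trivial
          calc _ ≤ B * B * (B * B) := by gcongr <;> exact hb _
            _ = B ^ 4 := by ring
      _ ≤ B ^ 4 * ℓ := by rw [abs_of_pos hL0]; gcongr
  -- without oscillation on the scale `ℓ`, the trivial bound is good enough
  rcases le_or_gt (ℓ * m) 1 with hlm | hlm
  · refine htriv.trans ?_
    have h1 : (ℓ * m) ^ 2 ≤ 1 := pow_le_one₀ (by positivity) hlm
    rw [mul_div_assoc', le_div_iff₀ (by positivity)]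
    have h2 : 0 ≤ B ^ 4 * ℓ := by positivity
    have h3 : 0 ≤ C * (B ^ 4 * ℓ) := by positivity
    nlinarith
  have hm0 : 0 < m := by
    by_contra! h
    have : m = 0 := le_antisymm h hm
    rw [this] at hlm; norm_num at hlm
  have hDc : ∀ x ∈ Set.Icc p q, m ≤ |D.eval x| ∧ |D.eval x| ≤ A * m := by
    have hcl : IsClosed {x | m ≤ |D.eval x| ∧ |D.eval x| ≤ A * m} :=
      (isClosed_le continuous_const D.continuous.abs).inter
        (isClosed_le D.continuous.abs continuous_const)
    rw [← closure_Ioo hpq.ne]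
    refine hcl.closure_subset_iff.mpr fun x hx => hD x fun i => ?_
    exact ⟨(hip i).trans_lt hx.1, hx.2.trans_le (hiq i)⟩
  -- the factor whose interval starts at `p` vanishes there to second order, which makes its size on
  -- `[p, q]` smaller by `(L / ℓ)²`
  set γ : Fin 4 → ℝ := fun i => if i = ip then B * (L / ℓ) ^ 2 else B with hγ
  have hγ0 : ∀ i, 0 ≤ γ i := fun i => by simp only [hγ]; split_ifs <;> positivity
  have hγp : γ 0 * γ 1 * (γ 2 * γ 3) = B ^ 4 * (L / ℓ) ^ 2 := by
    clear_value p
    fin_cases ip <;> simp [hγ] <;> ring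
  have hfγ : ∀ i, C2Bound (f i) (f₁ i) (f₂ i) (γ i) L (Set.Icc p q) := by
    intro i
    by_cases hi : i = ip
    · have h0 : ∀ x ≤ p, f i x = 0 := fun x hx =>
        hsupp i x fun h => absurd h.1 (not_lt.mpr (by rw [hi]; exact hx))
      have h1 := (hf i).of_vanish_left hpq (hpos i) (h0 p le_rfl)
        (eq_zero_of_hasDerivAt_of_forall_le ((hf i).deriv₁ p) h0)
      have h2 : B * (L / (r i - l i)) ^ 2 ≤ γ i := by
        simp only [hγ, hi, if_true]
        have h3 : 0 ≤ L / (r ip - l ip) := div_nonneg hL0.le (hpos ip).le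
        have h4 := hj ip
        gcongr
      refine ⟨h1.deriv₁, h1.deriv₂, h1.cont, fun x hx => (h1.bound₀ x hx).trans h2,
        fun x hx => (h1.bound₁ x hx).trans ?_, fun x hx => (h1.bound₂ x hx).trans ?_⟩
      · gcongr
      · gcongr
    · have : γ i = B := by simp [hγ, hi]
      rw [this]
      exact (hf i).weaken hB.le le_rfl hL0 (hLi i)
  have h01 := (hfγ 0).mul (hfγ 1) (hγ0 0) (hγ0 1) hL0
  have h23 := (hfγ 2).mul (hfγ 3) (hγ0 2) (hγ0 3) hL0
  have hall := h01.mul h23 (by have := hγ0 0; have := hγ0 1; positivity)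
    (by have := hγ0 2; have := hγ0 3; positivity) hL0
  have := hosc D hDn Φ hΦ p q m hpq hm0 hDc Ψ _ _ _ hall (hΨp p le_rfl) (hΨq q le_rfl)
    (eq_zero_of_hasDerivAt_of_forall_le (hall.deriv₁ p) hΨp)
    (eq_zero_of_hasDerivAt_of_forall_ge (hall.deriv₁ q) hΨq)
  refine this.trans ?_
  have e1 : 4 * (4 * (γ 0 * γ 1) * (4 * (γ 2 * γ 3))) = 64 * (B ^ 4 * (L / ℓ) ^ 2) := by
    rw [← hγp]; ring
  rw [e1]
  have e2 : C * (64 * (B ^ 4 * (L / ℓ) ^ 2)) * L / (L * m) ^ 2 =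
      64 * C * B ^ 4 * (L / (ℓ * m) ^ 2) := by
    field_simp
  rw [e2]
  have e3 : L / (ℓ * m) ^ 2 ≤ 2 * (ℓ / (1 + (ℓ * m) ^ 2)) := by
    rw [mul_div_assoc', div_le_div_iff₀ (by positivity) (by positivity)]
    have : 1 ≤ (ℓ * m) ^ 2 := one_le_pow₀ hlm.le
    nlinarith [mul_le_mul hLℓ (le_refl ((ℓ * m) ^ 2)) (by positivity) hℓ0.le]
  have e4 : 0 ≤ ℓ / (1 + (ℓ * m) ^ 2) := by positivity
  calc 64 * C * B ^ 4 * (L / (ℓ * m) ^ 2)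
      ≤ 64 * C * B ^ 4 * (2 * (ℓ / (1 + (ℓ * m) ^ 2))) := by gcongr
    _ ≤ 2 * ((1 + C * 64) * B ^ 4) * (ℓ / (1 + (ℓ * m) ^ 2)) := by
      have : 0 ≤ B ^ 4 * (ℓ / (1 + (ℓ * m) ^ 2)) := by positivity
      nlinarith

/-! ### Averages of variable width -/

/-- The Cauchy–Schwarz inequality for lower Lebesgue integrals. -/
lemma sq_lintegral_mul_le {X : Type*} [MeasurableSpace X] {μ : Measure X} {f g : X → ℝ≥0∞}
    (hf : AEMeasurable f μ) (hg : AEMeasurable g μ) :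
    (∫⁻ x, f x * g x ∂μ) ^ 2 ≤ (∫⁻ x, f x ^ 2 ∂μ) * ∫⁻ x, g x ^ 2 ∂μ := by
  have h := ENNReal.lintegral_mul_le_Lp_mul_Lq μ Real.HolderConjugate.two_two hf hg
  simp only [Pi.mul_apply, ENNReal.rpow_two] at h
  calc _ ≤ ((∫⁻ x, f x ^ 2 ∂μ) ^ (1 / 2 : ℝ) * (∫⁻ x, g x ^ 2 ∂μ) ^ (1 / 2 : ℝ)) ^ 2 := by gcongr
    _ = _ := by
      rw [mul_pow, ← ENNReal.rpow_two, ← ENNReal.rpow_mul, ← ENNReal.rpow_two, ← ENNReal.rpow_mul]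
      norm_num

/-- The value at `r` of a bump of height `v` and width `1 / v`. -/
def cauchyBump (v r : ℝ) : ℝ := v / (1 + (v * r) ^ 2)

lemma cauchyBump_nonneg {v : ℝ} (hv : 0 ≤ v) (r : ℝ) : 0 ≤ cauchyBump v r := by
  unfold cauchyBump; positivity

lemma cauchyBump_le {v : ℝ} (hv : 0 ≤ v) (r : ℝ) : cauchyBump v r ≤ v :=
  div_le_self hv (by nlinarith [sq_nonneg (v * r)])

lemma lintegral_cauchyBump_le {v : ℝ} (hv : 0 ≤ v) (y : ℝ) :
    ∫⁻ z, ENNReal.ofReal (cauchyBump v (y - z)) ≤ ENNReal.ofReal Real.pi := by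
  rcases hv.eq_or_lt with rfl | hv
  · simp [cauchyBump]
  have h1 : ∫ z, cauchyBump v (y - z) = Real.pi := by
    rw [integral_sub_left_eq_self (cauchyBump v) volume y]
    simp only [cauchyBump, div_eq_mul_inv]
    rw [integral_const_mul, Measure.integral_comp_mul_left (fun x => (1 + x ^ 2)⁻¹) v,
      integral_univ_inv_one_add_sq, abs_of_pos (inv_pos.mpr hv), smul_eq_mul]
    field_simp
  rw [← ofReal_integral_eq_lintegral_ofReal, h1]
  · by_contra hni
    rw [integral_undef hni] at h1
    exact Real.pi_ne_zero h1.symm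
  · exact Filter.Eventually.of_forall fun z => cauchyBump_nonneg hv.le _

/-- At a point `z`, at least one of `|y - z|`, `|y' - z|` is at least half of `|y - y'|`. -/
lemma cauchyBump_mul_le {v v' : ℝ} (hv : 0 ≤ v) (hv' : 0 ≤ v') (y y' z : ℝ) :
    cauchyBump v (y - z) * cauchyBump v' (y' - z) ≤
      4 * cauchyBump v (y - y') * cauchyBump v' (y' - z) +
        4 * cauchyBump v' (y' - y) * cauchyBump v (y - z) := by
  have key : ∀ {v : ℝ}, 0 ≤ v → ∀ {r s : ℝ}, s ^ 2 ≤ 4 * r ^ 2 →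
      cauchyBump v r ≤ 4 * cauchyBump v s := by
    intro v hv r s hrs
    unfold cauchyBump
    rw [mul_div_assoc', div_le_div_iff₀ (by positivity) (by positivity)]
    nlinarith [mul_nonneg (pow_nonneg hv 3) (sub_nonneg.mpr hrs)]
  have n1 := cauchyBump_nonneg hv (y - z)
  have n2 := cauchyBump_nonneg hv' (y' - z)
  have n3 := cauchyBump_nonneg hv (y - y')
  have n4 := cauchyBump_nonneg hv' (y' - y)
  by_cases h : (y - y') ^ 2 ≤ 4 * (y - z) ^ 2
  · have := key hv h
    nlinarith [mul_nonneg n4 n1]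
  · have h' : (y' - y) ^ 2 ≤ 4 * (y' - z) ^ 2 := by
      by_contra h'
      push Not at h h'
      nlinarith [sq_nonneg (y - z + (y' - z)), sq_nonneg (y - z - (y' - z))]
    have := key hv' h'
    nlinarith [mul_nonneg n3 n2]

/-- Averages over intervals whose length varies with the centre are bounded on `L²`, uniformly in
the choice of the lengths. If `P` is the adjoint of the averaging operator, then
`‖P g‖² ≤ 8π ⟨g, P g⟩` for `g ≥ 0`, because the product of two such bumps has integral controlled
by the bumps themselves; this bounds `‖P g‖`. -/
lemma lintegral_cauchyBump_mul_mul_le {v : ℝ → ℝ} (hv : Measurable v) (hv0 : ∀ y, 0 ≤ v y) {V : ℝ}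
    (hV : ∀ y, v y ≤ V) {g : ℝ → ℝ≥0∞} (hg : Measurable g) (hg1 : ∫⁻ y, g y ≠ ⊤) :
    ∫⁻ y, ∫⁻ z, ENNReal.ofReal (cauchyBump (v y) (y - z)) * (g y * g z) ≤
      ENNReal.ofReal (8 * Real.pi) * ∫⁻ y, g y ^ 2 := by
  set k : ℝ → ℝ → ℝ≥0∞ := fun y z => ENNReal.ofReal (cauchyBump (v y) (y - z)) with hk
  have hkm : Measurable fun p : ℝ × ℝ => k p.1 p.2 := by
    simp only [hk, cauchyBump]; fun_prop
  have hkm1 : ∀ y, Measurable fun z => k y z := fun y => hkm.comp measurable_prodMk_left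
  have hkm2 : ∀ z, Measurable fun y => k y z := fun z => hkm.comp measurable_prodMk_right
  set P : ℝ → ℝ≥0∞ := fun z => ∫⁻ y, k y z * g y with hP
  have hkg : Measurable fun p : ℝ × ℝ => k p.1 p.2 * g p.1 := hkm.mul (hg.comp measurable_fst)
  have hPm : Measurable P := hkg.lintegral_prod_left'
  have hkg1 : ∀ z, Measurable fun y => k y z * g y := fun z => (hkm2 z).mul hg
  have hkk1 : ∀ y y', Measurable fun z => k y z * k y' z := fun y y' => (hkm1 y).mul (hkm1 y')
  set F := ∫⁻ z, g z * P z with hF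
  have hFeq : ∫⁻ y, ∫⁻ z, k y z * (g y * g z) = F := by
    rw [lintegral_lintegral_swap]
    · refine lintegral_congr fun z => ?_
      simp only [hP]
      rw [← lintegral_const_mul _ (hkg1 z)]
      refine lintegral_congr fun y => ?_
      ring
    · exact (hkm.mul ((hg.comp measurable_fst).mul (hg.comp measurable_snd))).aemeasurable
  have hkk : ∀ y y', ∫⁻ z, k y z * k y' z ≤ ENNReal.ofReal (4 * Real.pi) * (k y y' + k y' y) := by
    intro y y'
    have e1 : ∀ z, k y z * k y' z ≤
        ENNReal.ofReal 4 * k y y' * k y' z + ENNReal.ofReal 4 * k y' y * k y z := by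
      intro z
      have n : ∀ y z, 0 ≤ cauchyBump (v y) (y - z) := fun y z => cauchyBump_nonneg (hv0 y) _
      have n1 := n y z
      have n2 := n y' z
      have n3 := n y y'
      have n4 := n y' y
      simp only [hk]
      rw [← ENNReal.ofReal_mul n1, ← ENNReal.ofReal_mul (by norm_num),
        ← ENNReal.ofReal_mul (by positivity), ← ENNReal.ofReal_mul (by norm_num),
        ← ENNReal.ofReal_mul (by positivity), ← ENNReal.ofReal_add (by positivity) (by positivity)]
      exact ENNReal.ofReal_le_ofReal (cauchyBump_mul_le (hv0 y) (hv0 y') y y' z)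
    calc _ ≤ ∫⁻ z, (ENNReal.ofReal 4 * k y y' * k y' z + ENNReal.ofReal 4 * k y' y * k y z) :=
          lintegral_mono e1
      _ = ENNReal.ofReal 4 * k y y' * (∫⁻ z, k y' z) +
          ENNReal.ofReal 4 * k y' y * ∫⁻ z, k y z := by
        rw [lintegral_add_left ((hkm1 y').const_mul _), lintegral_const_mul _ (hkm1 y'),
          lintegral_const_mul _ (hkm1 y)]
      _ ≤ ENNReal.ofReal 4 * k y y' * ENNReal.ofReal Real.pi +
          ENNReal.ofReal 4 * k y' y * ENNReal.ofReal Real.pi := by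
        gcongr <;> exact lintegral_cauchyBump_le (hv0 _) _
      _ = _ := by rw [ENNReal.ofReal_mul (by norm_num)]; ring
  have hPP : ∫⁻ z, P z ^ 2 ≤ ENNReal.ofReal (8 * Real.pi) * F := by
    have e1 : ∫⁻ z, P z ^ 2 = ∫⁻ y, ∫⁻ y', g y * g y' * ∫⁻ z, k y z * k y' z := by
      calc ∫⁻ z, P z ^ 2 = ∫⁻ z, ∫⁻ y, ∫⁻ y', k y z * g y * (k y' z * g y') := by
            refine lintegral_congr fun z => ?_
            rw [pow_two]
            simp only [hP]
            rw [← lintegral_mul_const _ (hkg1 z)]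
            refine lintegral_congr fun y => ?_
            rw [← lintegral_const_mul _ (hkg1 z)]
        _ = ∫⁻ y, ∫⁻ z, ∫⁻ y', k y z * g y * (k y' z * g y') := by
            rw [lintegral_lintegral_swap]
            refine Measurable.aemeasurable ?_
            refine Measurable.lintegral_prod_right' (f := fun q : (ℝ × ℝ) × ℝ =>
              k q.1.2 q.1.1 * g q.1.2 * (k q.2 q.1.1 * g q.2)) ?_
            simp only [hk, cauchyBump]; fun_prop
        _ = ∫⁻ y, ∫⁻ y', ∫⁻ z, k y z * g y * (k y' z * g y') := by
            refine lintegral_congr fun y => ?_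
            rw [lintegral_lintegral_swap]
            simp only [hk, cauchyBump]; fun_prop
        _ = _ := by
            refine lintegral_congr fun y => lintegral_congr fun y' => ?_
            rw [← lintegral_const_mul _ (hkk1 y y')]
            refine lintegral_congr fun z => ?_
            ring
    have e2 : ∫⁻ y, ∫⁻ y', g y * g y' * k y' y = F := by
      rw [← hFeq, lintegral_lintegral_swap]
      · refine lintegral_congr fun y => lintegral_congr fun y' => ?_
        ring
      · simp only [hk, cauchyBump]; fun_prop
    have e3 : ∫⁻ y, ∫⁻ y', g y * g y' * k y y' = F := by
      rw [← hFeq]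
      refine lintegral_congr fun y => lintegral_congr fun y' => ?_
      ring
    rw [e1]
    calc _ ≤ ∫⁻ y, ∫⁻ y', g y * g y' * (ENNReal.ofReal (4 * Real.pi) * (k y y' + k y' y)) := by
          gcongr with y y'; exact hkk y y'
      _ = ∫⁻ y, (ENNReal.ofReal (4 * Real.pi) * (∫⁻ y', g y * g y' * k y y') +
          ENNReal.ofReal (4 * Real.pi) * ∫⁻ y', g y * g y' * k y' y) := by
          refine lintegral_congr fun y => ?_
          rw [← lintegral_const_mul _ (by fun_prop), ← lintegral_const_mul _ (by fun_prop),
            ← lintegral_add_left (by fun_prop)]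
          refine lintegral_congr fun y' => ?_
          ring
      _ = ENNReal.ofReal (4 * Real.pi) * (∫⁻ y, ∫⁻ y', g y * g y' * k y y') +
          ENNReal.ofReal (4 * Real.pi) * ∫⁻ y, ∫⁻ y', g y * g y' * k y' y := by
          have m1 : Measurable fun y => ∫⁻ y', g y * g y' * k y y' :=
            Measurable.lintegral_prod_right' (f := fun q : ℝ × ℝ => g q.1 * g q.2 * k q.1 q.2)
              (by fun_prop)
          have m2 : Measurable fun y => ∫⁻ y', g y * g y' * k y' y :=
            Measurable.lintegral_prod_right' (f := fun q : ℝ × ℝ => g q.1 * g q.2 * k q.2 q.1)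
              (by simp only [hk, cauchyBump]; fun_prop)
          rw [lintegral_add_left (m1.const_mul _), lintegral_const_mul _ m1,
            lintegral_const_mul _ m2]
      _ = _ := by
          rw [e2, e3, ← add_mul, ← ENNReal.ofReal_add (by positivity) (by positivity)]
          ring_nf
  have hCS : F ^ 2 ≤ (∫⁻ y, g y ^ 2) * ∫⁻ z, P z ^ 2 :=
    sq_lintegral_mul_le hg.aemeasurable hPm.aemeasurable
  -- finiteness, needed only to cancel a factor `F` below; the bound `V` does not enter the estimate
  have hPfin : ∫⁻ z, P z ^ 2 ≠ ⊤ := by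
    have hPb : ∀ z, P z ≤ ENNReal.ofReal V * ∫⁻ y, g y := by
      intro z
      rw [← lintegral_const_mul _ hg]
      refine lintegral_mono fun y => ?_
      gcongr
      exact ENNReal.ofReal_le_ofReal ((cauchyBump_le (hv0 y) _).trans (hV y))
    have hP1 : ∫⁻ z, P z ≤ ENNReal.ofReal Real.pi * ∫⁻ y, g y := by
      rw [← lintegral_const_mul _ hg, hP, lintegral_lintegral_swap]
      · refine lintegral_mono fun y => ?_
        rw [lintegral_mul_const _ (hkm1 y)]
        gcongr
        exact lintegral_cauchyBump_le (hv0 y) y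
      · simp only [hk, cauchyBump]; fun_prop
    refine ne_top_of_le_ne_top (b := (ENNReal.ofReal V * ∫⁻ y, g y) *
      (ENNReal.ofReal Real.pi * ∫⁻ y, g y)) ?_ ?_
    · exact ENNReal.mul_ne_top (ENNReal.mul_ne_top ENNReal.ofReal_ne_top hg1)
        (ENNReal.mul_ne_top ENNReal.ofReal_ne_top hg1)
    · calc ∫⁻ z, P z ^ 2 ≤ ∫⁻ z, (ENNReal.ofReal V * ∫⁻ y, g y) * P z := by
            refine lintegral_mono fun z => ?_
            rw [pow_two]
            gcongr
            exact hPb z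
        _ = (ENNReal.ofReal V * ∫⁻ y, g y) * ∫⁻ z, P z := lintegral_const_mul _ hPm
        _ ≤ _ := by gcongr
  rw [hFeq]
  by_cases hG : ∫⁻ y, g y ^ 2 = ⊤
  · rw [hG, ENNReal.mul_top (by simp [Real.pi_pos])]
    exact le_top
  have hFfin : F ≠ ⊤ := by
    intro h
    rw [h] at hCS
    simp only [ne_eq, OfNat.ofNat_ne_zero, not_false_eq_true, ENNReal.top_pow, top_le_iff] at hCS
    exact ENNReal.mul_ne_top hG hPfin hCS
  by_cases hF0 : F = 0
  · rw [hF0]; exact zero_le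
  have : F * F ≤ F * (ENNReal.ofReal (8 * Real.pi) * ∫⁻ y, g y ^ 2) := by
    calc F * F = F ^ 2 := (pow_two F).symm
      _ ≤ (∫⁻ y, g y ^ 2) * (ENNReal.ofReal (8 * Real.pi) * F) := hCS.trans (by gcongr)
      _ = _ := by ring
  exact (ENNReal.mul_le_mul_iff_right hF0 hFfin).mp this

/-! ### Expanding the square of an `L²` norm -/

section Square

variable {w : ℝ → ℝ → ℂ}

lemma lintegral_ofReal_eq_enorm_integral {r : ℝ → ℝ} (hr : ∀ u, 0 ≤ r u)
    (hi : Integrable fun u => (r u : ℂ)) :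
    ∫⁻ u, ENNReal.ofReal (r u) = ‖∫ u, (r u : ℂ)‖ₑ := by
  have hi' : Integrable r := by simpa using hi.re
  rw [← ofReal_integral_eq_lintegral_ofReal hi' (Filter.Eventually.of_forall hr),
    integral_complex_ofReal, ← ofReal_norm, Complex.norm_real, Real.norm_eq_abs,
    abs_of_nonneg (integral_nonneg hr)]

lemma ofReal_norm_sq_eq (z : ℂ) : ENNReal.ofReal (‖z‖ ^ 2) = ‖z‖ₑ ^ 2 := by
  rw [ENNReal.ofReal_pow (norm_nonneg _), ofReal_norm]

lemma norm_sq_integral_eq (w : ℝ → ℝ → ℂ) (u : ℝ) :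
    ((‖∫ y, w u y‖ ^ 2 : ℝ) : ℂ) = (∫ y, w u y) * ∫ y, conj (w u y) := by
  rw [← Complex.normSq_eq_norm_sq, ← Complex.mul_conj, ← integral_conj]

/-- The `L²` norm of `u ↦ ∫ w(u, y) dy`, with its square expanded and the integration in `u` carried
out first. -/
lemma lintegral_enorm_integral_sq_le (hw : Measurable fun p : ℝ × ℝ => w p.1 p.2)
    (hfin : ∫⁻ u, (∫⁻ y, ‖w u y‖ₑ) ^ 2 ≠ ⊤) :
    ∫⁻ u, ‖∫ y, w u y‖ₑ ^ 2 ≤ ∫⁻ q : ℝ × ℝ, ‖∫ u, w u q.1 * conj (w u q.2)‖ₑ := by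
  set W : ℝ × (ℝ × ℝ) → ℂ := fun q => w q.1 q.2.1 * conj (w q.1 q.2.2) with hW
  have hw1 : ∀ u, Measurable fun y => w u y := fun u => hw.comp measurable_prodMk_left
  have hw' : ∀ {X : Type} [MeasurableSpace X] {a b : X → ℝ}, Measurable a → Measurable b →
      Measurable fun x => w (a x) (b x) := fun ha hb => hw.comp (ha.prodMk hb)
  have hWm : Measurable W := by
    have h1 := hw' (measurable_fst (α := ℝ) (β := ℝ × ℝ)) (measurable_fst.comp measurable_snd)
    have h2 := hw' (measurable_fst (α := ℝ) (β := ℝ × ℝ)) (measurable_snd.comp measurable_snd)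
    exact h1.mul (Complex.continuous_conj.measurable.comp h2)
  have hWi : Integrable W := by
    refine ⟨hWm.aestronglyMeasurable, ?_⟩
    rw [HasFiniteIntegral, Measure.volume_eq_prod, lintegral_prod _ hWm.enorm.aemeasurable]
    refine lt_of_eq_of_lt (lintegral_congr fun u => ?_) (lt_top_iff_ne_top.mpr hfin)
    rw [pow_two, ← lintegral_prod_mul (hw1 u).enorm.aemeasurable (hw1 u).enorm.aemeasurable]
    refine lintegral_congr fun q => ?_
    simp only [hW, enorm_mul, RCLike.enorm_conj]
  have hWi' : Integrable W (volume.prod volume) := hWi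
  have hT : ∀ u, ((‖∫ y, w u y‖ ^ 2 : ℝ) : ℂ) = ∫ q, W (u, q) := by
    intro u
    rw [norm_sq_integral_eq, ← integral_prod_mul]
    rfl
  calc ∫⁻ u, ‖∫ y, w u y‖ₑ ^ 2 = ‖∫ u, ((‖∫ y, w u y‖ ^ 2 : ℝ) : ℂ)‖ₑ := by
        simp only [← ofReal_norm_sq_eq]
        refine lintegral_ofReal_eq_enorm_integral (fun u => by positivity) ?_
        simp only [hT]
        exact hWi'.integral_prod_left
    _ = ‖∫ q : ℝ × ℝ, ∫ u, W (u, q)‖ₑ := by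
        simp only [hT]
        rw [integral_integral_swap hWi']
    _ ≤ _ := enorm_integral_le_lintegral_enorm _

/-- The `L²` norm of `u ↦ ∫ w(u, y) dy`, with its square expanded and the integration in the
difference `t = y - y'` carried out last. -/
lemma lintegral_enorm_integral_sq_le_diff (hw : Measurable fun p : ℝ × ℝ => w p.1 p.2)
    (hfin : ∫⁻ u, (∫⁻ y, ‖w u y‖ₑ) ^ 2 ≠ ⊤) :
    ∫⁻ u, ‖∫ y, w u y‖ₑ ^ 2 ≤
      ∫⁻ t, ‖∫ p : ℝ × ℝ, w p.1 p.2 * conj (w p.1 (p.2 - t))‖ₑ := by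
  set W : (ℝ × ℝ) × ℝ → ℂ := fun q => w q.1.1 q.1.2 * conj (w q.1.1 (q.1.2 - q.2)) with hW
  have hw1 : ∀ u, Measurable fun y => w u y := fun u => hw.comp measurable_prodMk_left
  have hw' : ∀ {X : Type} [MeasurableSpace X] {a b : X → ℝ}, Measurable a → Measurable b →
      Measurable fun x => w (a x) (b x) := fun ha hb => hw.comp (ha.prodMk hb)
  have hWm : Measurable W := by
    have h1 := hw' (X := (ℝ × ℝ) × ℝ) (a := fun q => q.1.1) (b := fun q => q.1.2)
      (by fun_prop) (by fun_prop)
    have h2 := hw' (X := (ℝ × ℝ) × ℝ) (a := fun q => q.1.1) (b := fun q => q.1.2 - q.2)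
      (by fun_prop) (by fun_prop)
    exact h1.mul (Complex.continuous_conj.measurable.comp h2)
  have hWi : Integrable W := by
    refine ⟨hWm.aestronglyMeasurable, ?_⟩
    have e1 : ∀ p : ℝ × ℝ, ∫⁻ t, ‖W (p, t)‖ₑ = ‖w p.1 p.2‖ₑ * ∫⁻ y, ‖w p.1 y‖ₑ := by
      intro p
      simp only [hW, enorm_mul, RCLike.enorm_conj]
      rw [lintegral_const_mul, lintegral_sub_left_eq_self (fun y => ‖w p.1 y‖ₑ) p.2]
      exact (hw' measurable_const (by fun_prop)).enorm
    have hIm : Measurable fun u => ∫⁻ y, ‖w u y‖ₑ := hw.enorm.lintegral_prod_right'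
    rw [HasFiniteIntegral, Measure.volume_eq_prod, lintegral_prod _ hWm.enorm.aemeasurable]
    simp only [e1]
    have hm : Measurable fun p : ℝ × ℝ => ‖w p.1 p.2‖ₑ * ∫⁻ y, ‖w p.1 y‖ₑ :=
      hw.enorm.mul (hIm.comp measurable_fst)
    rw [Measure.volume_eq_prod, lintegral_prod _ hm.aemeasurable]
    refine lt_of_eq_of_lt (lintegral_congr fun u => ?_) (lt_top_iff_ne_top.mpr hfin)
    rw [pow_two, ← lintegral_mul_const _ (hw1 u).enorm]
  have hWi' : Integrable W (volume.prod volume) := hWi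
  have hWi2 : Integrable (fun p : ℝ × ℝ => ∫ t, W (p, t)) (volume.prod volume) :=
    hWi'.integral_prod_left
  have hT : ∀ u, ((‖∫ y, w u y‖ ^ 2 : ℝ) : ℂ) = ∫ y, ∫ t, W ((u, y), t) := by
    intro u
    rw [norm_sq_integral_eq, ← integral_mul_const]
    refine integral_congr_ae (Filter.Eventually.of_forall fun y => ?_)
    simp only [hW]
    rw [integral_const_mul, integral_sub_left_eq_self (fun y => conj (w u y)) volume y]
  calc ∫⁻ u, ‖∫ y, w u y‖ₑ ^ 2 = ‖∫ u, ((‖∫ y, w u y‖ ^ 2 : ℝ) : ℂ)‖ₑ := by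
        simp only [← ofReal_norm_sq_eq]
        refine lintegral_ofReal_eq_enorm_integral (fun u => by positivity) ?_
        simp only [hT]
        exact hWi2.integral_prod_left
    _ = ‖∫ t, ∫ p : ℝ × ℝ, W (p, t)‖ₑ := by
        simp only [hT]
        rw [← integral_prod _ hWi2, integral_integral_swap hWi']
        rfl
    _ ≤ _ := enorm_integral_le_lintegral_enorm _

end Square

/-! ### The kernel on a trapezoid with good chords -/

namespace C2Bound

variable {f f₁ f₂ : ℝ → ℂ} {G L : ℝ}

lemma conjugate (hf : C2Bound f f₁ f₂ G L Set.univ) :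
    C2Bound (fun x => conj (f x)) (fun x => conj (f₁ x)) (fun x => conj (f₂ x)) G L Set.univ where
  deriv₁ x := (hf.deriv₁ x).star
  deriv₂ x := (hf.deriv₂ x).star
  cont := Complex.continuous_conj.comp hf.cont
  bound₀ _ hx := by rw [RCLike.norm_conj]; exact hf.bound₀ _ hx
  bound₁ _ hx := by rw [RCLike.norm_conj]; exact hf.bound₁ _ hx
  bound₂ _ hx := by rw [RCLike.norm_conj]; exact hf.bound₂ _ hx

lemma comp_add (hf : C2Bound f f₁ f₂ G L Set.univ) (t : ℝ) :
    C2Bound (fun x => f (x + t)) (fun x => f₁ (x + t)) (fun x => f₂ (x + t)) G L Set.univ where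
  deriv₁ x := (hf.deriv₁ (x + t)).comp_add_const x t
  deriv₂ x := (hf.deriv₂ (x + t)).comp_add_const x t
  cont := hf.cont.comp (continuous_id.add continuous_const)
  bound₀ _ _ := hf.bound₀ _ trivial
  bound₁ _ _ := hf.bound₁ _ trivial
  bound₂ _ _ := hf.bound₂ _ trivial

end C2Bound

/-- Membership in the curved trapezoid, in terms of the two coordinates. -/
def InTrapezoid (a b : ℝ) (α β : ℝ → ℝ) (x y : ℝ) : Prop :=
  y ∈ Set.Ioo a b ∧ x ∈ Set.Ioo (α y) (β y)

/-- The monotonicity of the two boundary curves makes vertical sections convex. -/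
lemma IsTrapezoidData.inTrapezoid_of_mem_uIcc {a b : ℝ} {α β : ℝ → ℝ} (h : IsTrapezoidData a b α β)
    {x y y' ξ : ℝ} (hy : InTrapezoid a b α β x y) (hy' : InTrapezoid a b α β x y')
    (hξ : ξ ∈ Set.uIcc y y') : InTrapezoid a b α β x ξ := by
  wlog hle : y ≤ y' generalizing y y'
  · exact this hy' hy (by rwa [Set.uIcc_comm]) (le_of_not_ge hle)
  rw [Set.uIcc_of_le hle] at hξ
  have hξ' : ξ ∈ Set.Ioo a b := ⟨hy.1.1.trans_le hξ.1, hξ.2.trans_lt hy'.1.2⟩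
  have e := Set.Ioo_subset_Icc_self hξ'
  have e1 := Set.Ioo_subset_Icc_self hy.1
  have e2 := Set.Ioo_subset_Icc_self hy'.1
  refine ⟨hξ', ?_, ?_⟩
  · rcases h.monotone_left with hm | hm
    · exact (hm e e2 hξ.2).trans_lt hy'.2.1
    · exact (hm e1 e hξ.1).trans_lt hy.2.1
  · rcases h.monotone_right with hm | hm
    · exact hy.2.2.trans_le (hm e1 e hξ.1)
    · exact hy'.2.2.trans_le (hm e e2 hξ.2)

/-- The length `β(y) - α(y)` of the section at height `y`, extended by zero. -/
def sectionWidth (a b : ℝ) (α β : ℝ → ℝ) (y : ℝ) : ℝ := (Set.Ioo a b).indicator (fun y => β y - α y) y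

/-- An amplitude adapted to a curved trapezoid: it vanishes off the trapezoid, and on each horizontal
section it is `C²` at the scale of that section. -/
structure IsAdapted (a b : ℝ) (α β : ℝ → ℝ) (φ : ℝ → ℝ → ℂ) (B : ℝ) : Prop where
  data : IsTrapezoidData a b α β
  measurable : Measurable fun p : ℝ × ℝ => φ p.1 p.2
  eq_zero : ∀ x y, ¬ InTrapezoid a b α β x y → φ x y = 0
  bound : ∀ y ∈ Set.Ioo a b, ∃ φ₁ φ₂ : ℝ → ℂ,
    C2Bound (fun x => φ x y) φ₁ φ₂ B (β y - α y) Set.univ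

/-- The phase `S` has good chords on the trapezoid: `|H|` is comparable to `μ` along every
antidiagonal segment with ends in the trapezoid. -/
def HasGoodChords (a b : ℝ) (α β : ℝ → ℝ) (S : MvPolynomial (Fin 2) ℝ) (A μ : ℝ) : Prop :=
  ∀ x y t, InTrapezoid a b α β x y → InTrapezoid a b α β (x + t) (y - t) → ∀ η ∈ Set.uIcc 0 t,
    μ / 2 ≤ |evalXY (mixedH S) (x + η) (y - η)| ∧
      |evalXY (mixedH S) (x + η) (y - η)| ≤ 2 * A * μ

/-- The difference `S(x, y) - S(x + t, y - t)` of the phase along an antidiagonal. -/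
def phaseDiff (S : MvPolynomial (Fin 2) ℝ) (t x y : ℝ) : ℝ := evalXY S x y - evalXY S (x + t) (y - t)

/-- The amplitude that goes with `phaseDiff`. -/
def ampDiff (φ : ℝ → ℝ → ℂ) (t x y : ℝ) : ℂ := φ x y * conj (φ (x + t) (y - t))

section Adapted

variable {a b : ℝ} {α β : ℝ → ℝ} {φ : ℝ → ℝ → ℂ} {B : ℝ}

lemma IsAdapted.norm_le (h : IsAdapted a b α β φ B) (hB : 0 ≤ B) (x y : ℝ) : ‖φ x y‖ ≤ B := by
  by_cases hy : y ∈ Set.Ioo a b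
  · obtain ⟨φ₁, φ₂, h1⟩ := h.bound y hy
    exact h1.bound₀ x trivial
  · rw [h.eq_zero x y fun h => hy h.1]; simpa using hB

lemma IsTrapezoidData.exists_abs_le (h : IsTrapezoidData a b α β) :
    ∃ R : ℝ, ∀ y ∈ Set.Ioo a b, |α y| ≤ R ∧ |β y| ≤ R := by
  obtain ⟨R₁, h1⟩ := isCompact_Icc.exists_bound_of_continuousOn h.continuousOn_left
  obtain ⟨R₂, h2⟩ := isCompact_Icc.exists_bound_of_continuousOn h.continuousOn_right
  exact ⟨max R₁ R₂, fun y hy => ⟨(h1 y (Set.Ioo_subset_Icc_self hy)).trans (le_max_left _ _),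
    (h2 y (Set.Ioo_subset_Icc_self hy)).trans (le_max_right _ _)⟩⟩

lemma IsTrapezoidData.measurable_sectionWidth (h : IsTrapezoidData a b α β) :
    Measurable (sectionWidth a b α β) := by
  have h1 : ContinuousOn (fun y => β y - α y) (Set.Ioo a b) :=
    (h.continuousOn_right.sub h.continuousOn_left).mono Set.Ioo_subset_Icc_self
  have h2 : sectionWidth a b α β = (Set.Ioo a b).piecewise (fun y => β y - α y) 0 :=
    (Set.piecewise_eq_indicator (s := Set.Ioo a b) (f := fun y => β y - α y)).symm
  rw [h2]
  classical
  exact h1.measurable_piecewise continuousOn_const measurableSet_Ioo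

lemma IsTrapezoidData.sectionWidth_nonneg (h : IsTrapezoidData a b α β) (y : ℝ) :
    0 ≤ sectionWidth a b α β y :=
  Set.indicator_nonneg (fun y hy => (sub_pos.mpr (h.left_lt_right y hy)).le) y

/-- The kernel of the second `TT*` argument. The derivative of its phase is a mixed second difference
of `∂ₓS`, hence comparable to `μ |t| |y - y'|`, and its amplitude is a product of four functions of
`x`, adapted to the sections at the heights `y`, `y - t`, `y'` and `y' - t`. -/
lemma exists_norm_integral_ampDiff_le (n : ℕ) (A B : ℝ) (hA : 0 < A) (hB : 0 < B) :
    ∃ C : ℝ, 0 < C ∧ ∀ (S : MvPolynomial (Fin 2) ℝ), S.totalDegree ≤ n →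
    ∀ (a b : ℝ) (α β : ℝ → ℝ) (φ : ℝ → ℝ → ℂ), IsAdapted a b α β φ B →
    ∀ μ : ℝ, 0 < μ → HasGoodChords a b α β S A μ → ∀ t : ℝ, t ≠ 0 → ∀ y y' : ℝ,
    ‖∫ x, Complex.exp (Complex.I * ((phaseDiff S t x y - phaseDiff S t x y' : ℝ) : ℂ)) *
        (ampDiff φ t x y * conj (ampDiff φ t x y'))‖ ≤
      C / (μ * |t|) *
        (cauchyBump (μ * |t| / 2 * sectionWidth a b α β y) (y - y') +
         cauchyBump (μ * |t| / 2 * sectionWidth a b α β (y - t)) (y - y') +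
         (cauchyBump (μ * |t| / 2 * sectionWidth a b α β y') (y' - y) +
         cauchyBump (μ * |t| / 2 * sectionWidth a b α β (y' - t)) (y' - y))) := by
  obtain ⟨C, hC, hker⟩ := exists_norm_kernel_le n (4 * A) B (by positivity) hB
  refine ⟨2 * C, by positivity, ?_⟩
  intro S hS a b α β φ hφ μ hμ hH t ht y y'
  have ht0 : 0 < |t| := abs_pos.mpr ht
  have hw := hφ.data.sectionWidth_nonneg
  have hnn : 0 ≤ 2 * C / (μ * |t|) *
        (cauchyBump (μ * |t| / 2 * sectionWidth a b α β y) (y - y') +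
         cauchyBump (μ * |t| / 2 * sectionWidth a b α β (y - t)) (y - y') +
         (cauchyBump (μ * |t| / 2 * sectionWidth a b α β y') (y' - y) +
         cauchyBump (μ * |t| / 2 * sectionWidth a b α β (y' - t)) (y' - y))) := by
    have h1 := cauchyBump_nonneg (mul_nonneg (by positivity : 0 ≤ μ * |t| / 2) (hw y)) (y - y')
    have h2 := cauchyBump_nonneg (mul_nonneg (by positivity : 0 ≤ μ * |t| / 2) (hw (y - t))) (y - y')
    have h3 := cauchyBump_nonneg (mul_nonneg (by positivity : 0 ≤ μ * |t| / 2) (hw y')) (y' - y)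
    have h4 := cauchyBump_nonneg (mul_nonneg (by positivity : 0 ≤ μ * |t| / 2) (hw (y' - t)))
      (y' - y)
    positivity
  have hzero : (∀ x, ampDiff φ t x y * conj (ampDiff φ t x y') = 0) →
      ‖∫ x, Complex.exp (Complex.I * ((phaseDiff S t x y - phaseDiff S t x y' : ℝ) : ℂ)) *
        (ampDiff φ t x y * conj (ampDiff φ t x y'))‖ ≤ _ := fun h => by
    simp only [h, mul_zero, integral_zero, norm_zero]
    exact hnn
  have hz : ∀ x z, z ∉ Set.Ioo a b → φ x z = 0 := fun x z h => hφ.eq_zero x z fun h' => h h'.1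
  by_cases hy0 : y ∈ Set.Ioo a b
  swap
  · exact hzero fun x => by simp [ampDiff, hz x y hy0]
  by_cases hy1 : y - t ∈ Set.Ioo a b
  swap
  · exact hzero fun x => by simp [ampDiff, hz (x + t) (y - t) hy1]
  by_cases hy2 : y' ∈ Set.Ioo a b
  swap
  · exact hzero fun x => by simp [ampDiff, hz x y' hy2]
  by_cases hy3 : y' - t ∈ Set.Ioo a b
  swap
  · exact hzero fun x => by simp [ampDiff, hz (x + t) (y' - t) hy3]
  obtain ⟨p₀, q₀, h₀⟩ := hφ.bound y hy0
  obtain ⟨p₁, q₁, h₁⟩ := hφ.bound (y - t) hy1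
  obtain ⟨p₂, q₂, h₂⟩ := hφ.bound y' hy2
  obtain ⟨p₃, q₃, h₃⟩ := hφ.bound (y' - t) hy3
  set P := MvPolynomial.pderiv 0 S with hP
  have hPn : P.totalDegree ≤ n := (totalDegree_pderiv_le 0 S).trans hS
  set D : Polynomial ℝ := sliceX P 0 y - sliceX P t (y - t) -
    (sliceX P 0 y' - sliceX P t (y' - t)) with hD
  have hDe : ∀ x, D.eval x = evalXY P x y - evalXY P (x + t) (y - t) -
      (evalXY P x y' - evalXY P (x + t) (y' - t)) := by
    intro x
    simp only [hD, Polynomial.eval_sub, eval_sliceX, add_zero]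
  have hDn : D.natDegree ≤ n := by
    have hs : ∀ c d, (sliceX P c d).natDegree ≤ n := fun c d =>
      (natDegree_sliceX_le P c d).trans hPn
    exact Polynomial.natDegree_sub_le_of_le (Polynomial.natDegree_sub_le_of_le (hs _ _) (hs _ _))
      (Polynomial.natDegree_sub_le_of_le (hs _ _) (hs _ _)) |>.trans (by simp)
  have hΦ : ∀ x, HasDerivAt (fun x => phaseDiff S t x y - phaseDiff S t x y') (D.eval x) x := by
    intro x
    have d1 : ∀ z, HasDerivAt (fun x => evalXY S x z) (evalXY P x z) x := fun z =>
      (hasDerivAt_evalXY S (hasDerivAt_id x) (hasDerivAt_const x z)).congr_deriv (by simp [hP])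
    have d2 : ∀ z, HasDerivAt (fun x => evalXY S (x + t) z) (evalXY P (x + t) z) x := fun z =>
      (hasDerivAt_evalXY S ((hasDerivAt_id x).add_const t) (hasDerivAt_const x z)).congr_deriv
        (by simp [hP])
    rw [hDe]
    exact ((d1 y).sub (d2 (y - t))).sub ((d1 y').sub (d2 (y' - t)))
  have hlt := hφ.data.left_lt_right
  have hbound := hker D hDn _ hΦ
    ![fun x => φ x y, fun x => conj (φ (x + t) (y - t)), fun x => conj (φ x y'),
      fun x => φ (x + t) (y' - t)]
    ![p₀, fun x => conj (p₁ (x + t)), fun x => conj (p₂ x), fun x => p₃ (x + t)]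
    ![q₀, fun x => conj (q₁ (x + t)), fun x => conj (q₂ x), fun x => q₃ (x + t)]
    ![α y, α (y - t) - t, α y', α (y' - t) - t]
    ![β y, β (y - t) - t, β y', β (y' - t) - t]
    (by
      have := hlt y hy0
      have := hlt _ hy1
      have := hlt y' hy2
      have := hlt _ hy3
      intro i
      fin_cases i <;> simp <;> linarith)
    (by
      intro i
      fin_cases i
      · exact h₀
      · simpa using (h₁.comp_add t).conjugate
      · exact h₂.conjugate
      · simpa using h₃.comp_add t)
    (by
      intro i x hx
      fin_cases i
      · exact hφ.eq_zero _ _ fun h => hx h.2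
      · refine (map_eq_zero _).mpr (hφ.eq_zero _ _ fun h => hx ?_)
        exact ⟨sub_lt_iff_lt_add.mpr h.2.1, lt_sub_iff_add_lt.mpr h.2.2⟩
      · exact (map_eq_zero _).mpr (hφ.eq_zero _ _ fun h => hx h.2)
      · refine hφ.eq_zero _ _ fun h => hx ?_
        exact ⟨sub_lt_iff_lt_add.mpr h.2.1, lt_sub_iff_add_lt.mpr h.2.2⟩)
    (μ / 2 * |t| * |y - y'|) (by positivity)
    (by
      intro x hx
      have k0 : InTrapezoid a b α β x y := ⟨hy0, hx 0⟩
      have k1 : InTrapezoid a b α β (x + t) (y - t) :=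
        ⟨hy1, sub_lt_iff_lt_add.mp (hx 1).1, lt_sub_iff_add_lt.mp (hx 1).2⟩
      have k2 : InTrapezoid a b α β x y' := ⟨hy2, hx 2⟩
      have k3 : InTrapezoid a b α β (x + t) (y' - t) :=
        ⟨hy3, sub_lt_iff_lt_add.mp (hx 3).1, lt_sub_iff_add_lt.mp (hx 3).2⟩
      obtain ⟨ξ, hξ, η, hη, e⟩ := exists_second_difference_eq S x y y' t
      have hξ' : ξ - t ∈ Set.uIcc (y - t) (y' - t) := by
        rw [Set.mem_uIcc] at hξ ⊢
        rcases hξ with h | h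
        · left; constructor <;> linarith [h.1, h.2]
        · right; constructor <;> linarith [h.1, h.2]
      obtain ⟨g1, g2⟩ := hH x ξ t (hφ.data.inTrapezoid_of_mem_uIcc k0 k2 hξ)
        (hφ.data.inTrapezoid_of_mem_uIcc k1 k3 hξ') η hη
      rw [hDe, e]
      have : 0 ≤ |y - y'| * |t| := by positivity
      constructor
      · calc μ / 2 * |t| * |y - y'| = |y - y'| * |t| * (μ / 2) := by ring
          _ ≤ _ := by gcongr
      · calc _ ≤ |y - y'| * |t| * (2 * A * μ) := by gcongr
          _ = _ := by ring)
  have hamp : ∀ x, ampDiff φ t x y * conj (ampDiff φ t x y') =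
      φ x y * conj (φ (x + t) (y - t)) * (conj (φ x y') * φ (x + t) (y' - t)) := by
    intro x
    simp [ampDiff]
  simp only [hamp]
  refine hbound.trans (le_of_eq ?_)
  have hsw : ∀ z ∈ Set.Ioo a b, sectionWidth a b α β z = β z - α z :=
    fun z hz => Set.indicator_of_mem hz _
  have hb : ∀ w r, |r| = |y - y'| → w / (1 + (w * (μ / 2 * |t| * |y - y'|)) ^ 2) =
      2 / (μ * |t|) * cauchyBump (μ * |t| / 2 * w) r := by
    intro w r hr
    have : (μ * |t| / 2 * w * r) ^ 2 = (w * (μ / 2 * |t| * |y - y'|)) ^ 2 := by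
      rw [← hr]
      simp only [mul_pow, div_pow, sq_abs]
      ring
    rw [cauchyBump, this]
    field_simp
  simp only [Fin.sum_univ_four, Matrix.cons_val_zero, Matrix.cons_val_one, Matrix.cons_val,
    sub_sub_sub_cancel_right]
  rw [hsw y hy0, hsw _ hy1, hsw y' hy2, hsw _ hy3, hb _ (y - y') rfl, hb _ (y - y') rfl,
    hb _ (y' - y) (abs_sub_comm _ _), hb _ (y' - y) (abs_sub_comm _ _)]
  ring

end Adapted

/-! ### The bilinear estimate -/

lemma measurable_phaseDiff (S : MvPolynomial (Fin 2) ℝ) (t : ℝ) :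
    Measurable fun p : ℝ × ℝ => phaseDiff S t p.1 p.2 := by
  unfold phaseDiff
  exact (continuous_evalXY continuous_fst continuous_snd S).measurable.sub
    (continuous_evalXY (continuous_fst.add continuous_const)
      (continuous_snd.sub continuous_const) S).measurable

lemma measurable_ampDiff {φ : ℝ → ℝ → ℂ} (hφ : Measurable fun p : ℝ × ℝ => φ p.1 p.2) (t : ℝ) :
    Measurable fun p : ℝ × ℝ => ampDiff φ t p.1 p.2 := by
  unfold ampDiff
  have h : Measurable fun p : ℝ × ℝ => φ (p.1 + t) (p.2 - t) :=
    hφ.comp (by fun_prop : Measurable fun p : ℝ × ℝ => (p.1 + t, p.2 - t))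
  exact hφ.mul (Complex.continuous_conj.measurable.comp h)

lemma enorm_exp_I_mul (r : ℝ) : ‖Complex.exp (Complex.I * (r : ℂ))‖ₑ = 1 := by
  rw [← ofReal_norm, mul_comm, Complex.norm_exp_ofReal_mul_I, ENNReal.ofReal_one]

lemma measurable_exp_I_mul {X : Type*} [MeasurableSpace X] {r : X → ℝ} (hr : Measurable r) :
    Measurable fun x => Complex.exp (Complex.I * (r x : ℂ)) := by
  fun_prop

/-- The bilinear estimate: the `TT*` method with `F` removed, the bound for the kernel and the
`L²` bound for averages of variable width. -/
lemma exists_enorm_bilinear_sq_le (n : ℕ) (A B : ℝ) (hA : 0 < A) (hB : 0 < B) :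
    ∃ C : ℝ, 0 < C ∧ ∀ (S : MvPolynomial (Fin 2) ℝ), S.totalDegree ≤ n →
    ∀ (a b : ℝ) (α β : ℝ → ℝ) (φ : ℝ → ℝ → ℂ), IsAdapted a b α β φ B →
    ∀ μ : ℝ, 0 < μ → HasGoodChords a b α β S A μ → ∀ t : ℝ, t ≠ 0 →
    ∀ F G : ℝ → ℂ, Measurable F → Measurable G → ∫⁻ y, ‖G y‖ₑ ≠ ⊤ →
    ‖∫ p : ℝ × ℝ, Complex.exp (Complex.I * (phaseDiff S t p.1 p.2 : ℂ)) * ampDiff φ t p.1 p.2 *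
        (F p.1 * G p.2)‖ₑ ^ 2 ≤
      ENNReal.ofReal (C / (μ * |t|)) * ((∫⁻ x, ‖F x‖ₑ ^ 2) * ∫⁻ y, ‖G y‖ₑ ^ 2) := by
  obtain ⟨C, hC, hker⟩ := exists_norm_integral_ampDiff_le n A B hA hB
  refine ⟨C * (4 * (8 * Real.pi)), by positivity, ?_⟩
  intro S hS a b α β φ hφ μ hμ hH t ht F G hF hG hG1
  have ht0 : 0 < |t| := abs_pos.mpr ht
  set w : ℝ → ℝ → ℂ := fun x y =>
    Complex.exp (Complex.I * (phaseDiff S t x y : ℂ)) * ampDiff φ t x y * G y with hw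
  have hwm : Measurable fun p : ℝ × ℝ => w p.1 p.2 :=
    ((measurable_exp_I_mul (measurable_phaseDiff S t)).mul
      (measurable_ampDiff hφ.measurable t)).mul (hG.comp measurable_snd)
  have hwF : ∀ p : ℝ × ℝ, Complex.exp (Complex.I * (phaseDiff S t p.1 p.2 : ℂ)) *
      ampDiff φ t p.1 p.2 * (F p.1 * G p.2) = F p.1 * w p.1 p.2 := fun p => by
    simp only [hw]; ring
  simp only [hwF]
  obtain ⟨R, hR⟩ := hφ.data.exists_abs_le
  have hamp : ∀ x y, ‖ampDiff φ t x y‖ₑ ≤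
      (Set.Icc (-R) R).indicator (fun _ => ENNReal.ofReal (B ^ 2)) x := by
    intro x y
    by_cases hx : x ∈ Set.Icc (-R) R
    · rw [Set.indicator_of_mem hx, ← ofReal_norm]
      refine ENNReal.ofReal_le_ofReal ?_
      rw [ampDiff, norm_mul, RCLike.norm_conj, pow_two]
      exact mul_le_mul (hφ.norm_le hB.le _ _) (hφ.norm_le hB.le _ _) (norm_nonneg _) hB.le
    · rw [ampDiff, hφ.eq_zero x y, zero_mul, enorm_zero]
      · exact zero_le
      · rintro ⟨hy, hxy⟩
        refine hx ⟨?_, ?_⟩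
        · linarith [neg_abs_le (α y), (hR y hy).1, hxy.1]
        · linarith [le_abs_self (β y), (hR y hy).2, hxy.2]
  have hfin : ∫⁻ x, (∫⁻ y, ‖w x y‖ₑ) ^ 2 ≠ ⊤ := by
    have h1 : ∀ x, (∫⁻ y, ‖w x y‖ₑ) ^ 2 ≤ (Set.Icc (-R) R).indicator
        (fun _ => (ENNReal.ofReal (B ^ 2) * ∫⁻ y, ‖G y‖ₑ) ^ 2) x := by
      intro x
      have h2 : ∫⁻ y, ‖w x y‖ₑ ≤
          (Set.Icc (-R) R).indicator (fun _ => ENNReal.ofReal (B ^ 2)) x * ∫⁻ y, ‖G y‖ₑ := by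
        rw [← lintegral_const_mul _ hG.enorm]
        refine lintegral_mono fun y => ?_
        simp only [hw, enorm_mul, enorm_exp_I_mul, one_mul]
        gcongr
        exact hamp x y
      refine (pow_le_pow_left' h2 2).trans (le_of_eq ?_)
      by_cases hx : x ∈ Set.Icc (-R) R <;> simp [hx]
    refine ne_top_of_le_ne_top ?_ (lintegral_mono h1)
    rw [lintegral_indicator measurableSet_Icc, setLIntegral_const]
    exact ENNReal.mul_ne_top (ENNReal.pow_ne_top (ENNReal.mul_ne_top ENNReal.ofReal_ne_top hG1))
      (by simp)
  have hTm : StronglyMeasurable fun x => ∫ y, w x y :=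
    hwm.stronglyMeasurable.integral_prod_right'
  -- Cauchy–Schwarz, to remove `F`
  have hCS : ‖∫ p : ℝ × ℝ, F p.1 * w p.1 p.2‖ₑ ^ 2 ≤
      (∫⁻ x, ‖F x‖ₑ ^ 2) * ∫⁻ x, ‖∫ y, w x y‖ₑ ^ 2 := by
    by_cases hi : Integrable fun p : ℝ × ℝ => F p.1 * w p.1 p.2
    · have h1 : ∫ p : ℝ × ℝ, F p.1 * w p.1 p.2 = ∫ x, F x * ∫ y, w x y := by
        rw [Measure.volume_eq_prod, integral_prod _ hi]
        simp only [integral_const_mul]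
      rw [h1]
      refine (pow_le_pow_left' (enorm_integral_le_lintegral_enorm _) 2).trans ?_
      simp only [enorm_mul]
      exact sq_lintegral_mul_le hF.enorm.aemeasurable hTm.measurable.enorm.aemeasurable
    · -- the integral is `0` by convention, so there is nothing to prove
      rw [integral_undef hi]
      simp
  refine hCS.trans ?_
  rw [mul_left_comm]
  gcongr
  refine (lintegral_enorm_integral_sq_le hwm hfin).trans ?_
  set v₁ : ℝ → ℝ := fun y => μ * |t| / 2 * sectionWidth a b α β y with hv₁
  set v₂ : ℝ → ℝ := fun y => μ * |t| / 2 * sectionWidth a b α β (y - t) with hv₂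
  have hsm := hφ.data.measurable_sectionWidth
  have hs0 := hφ.data.sectionWidth_nonneg
  have hv₁m : Measurable v₁ := hsm.const_mul _
  have hv₂m : Measurable v₂ := (hsm.comp (measurable_id.sub_const t)).const_mul _
  have hv₁0 : ∀ y, 0 ≤ v₁ y := fun y => mul_nonneg (by positivity) (hs0 _)
  have hv₂0 : ∀ y, 0 ≤ v₂ y := fun y => mul_nonneg (by positivity) (hs0 _)
  have hsb : ∀ y, sectionWidth a b α β y ≤ 2 * |R| := by
    intro y
    by_cases hy : y ∈ Set.Ioo a b
    · rw [sectionWidth, Set.indicator_of_mem hy]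
      linarith [neg_abs_le (α y), le_abs_self (β y), (hR y hy).1, (hR y hy).2, le_abs_self R]
    · rw [sectionWidth, Set.indicator_of_notMem hy]; positivity
  have hv₁b : ∀ y, v₁ y ≤ μ * |t| / 2 * (2 * |R|) := fun y => by
    simp only [hv₁]; gcongr; exact hsb y
  have hv₂b : ∀ y, v₂ y ≤ μ * |t| / 2 * (2 * |R|) := fun y => by
    simp only [hv₂]; gcongr; exact hsb _
  set k : (ℝ → ℝ) → ℝ → ℝ → ℝ≥0∞ := fun v y z =>
    ENNReal.ofReal (cauchyBump (v y) (y - z)) * (‖G y‖ₑ * ‖G z‖ₑ) with hk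
  have hkm : ∀ v, Measurable v → Measurable fun p : ℝ × ℝ => k v p.1 p.2 := by
    intro v hv
    simp only [hk, cauchyBump]
    have := hG.enorm
    fun_prop
  have hkm' : ∀ v, Measurable v → Measurable fun p : ℝ × ℝ => k v p.2 p.1 := fun v hv =>
    (hkm v hv).comp measurable_swap
  have hkI : ∀ v, Measurable v → (∀ y, 0 ≤ v y) → (∀ y, v y ≤ μ * |t| / 2 * (2 * |R|)) →
      ∫⁻ p : ℝ × ℝ, k v p.1 p.2 ≤ ENNReal.ofReal (8 * Real.pi) * ∫⁻ y, ‖G y‖ₑ ^ 2 := by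
    intro v hv hv0 hvb
    rw [Measure.volume_eq_prod, lintegral_prod _ (hkm v hv).aemeasurable]
    exact lintegral_cauchyBump_mul_mul_le hv hv0 hvb hG.enorm hG1
  have hkI' : ∀ v, Measurable v → (∀ y, 0 ≤ v y) → (∀ y, v y ≤ μ * |t| / 2 * (2 * |R|)) →
      ∫⁻ p : ℝ × ℝ, k v p.2 p.1 ≤ ENNReal.ofReal (8 * Real.pi) * ∫⁻ y, ‖G y‖ₑ ^ 2 := by
    intro v hv hv0 hvb
    rw [Measure.volume_eq_prod, lintegral_prod_symm _ (hkm' v hv).aemeasurable]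
    exact lintegral_cauchyBump_mul_mul_le hv hv0 hvb hG.enorm hG1
  have hpt : ∀ q : ℝ × ℝ, ‖∫ x, w x q.1 * conj (w x q.2)‖ₑ ≤ ENNReal.ofReal (C / (μ * |t|)) *
      (k v₁ q.1 q.2 + k v₂ q.1 q.2 + (k v₁ q.2 q.1 + k v₂ q.2 q.1)) := by
    rintro ⟨y, z⟩
    have e1 : ∫ x, w x y * conj (w x z) = (G y * conj (G z)) *
        ∫ x, Complex.exp (Complex.I * ((phaseDiff S t x y - phaseDiff S t x z : ℝ) : ℂ)) *
        (ampDiff φ t x y * conj (ampDiff φ t x z)) := by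
      rw [← integral_const_mul]
      refine integral_congr_ae (Filter.Eventually.of_forall fun x => ?_)
      have e2 : Complex.exp (Complex.I * ((phaseDiff S t x y - phaseDiff S t x z : ℝ) : ℂ)) =
          Complex.exp (Complex.I * (phaseDiff S t x y : ℂ)) *
          conj (Complex.exp (Complex.I * (phaseDiff S t x z : ℂ))) := by
        rw [← Complex.exp_conj, ← Complex.exp_add]
        congr 1
        simp
        ring
      simp only [hw, e2, map_mul]
      ring
    have e3 := hker S hS a b α β φ hφ μ hμ hH t ht y z
    have n1 := cauchyBump_nonneg (hv₁0 y) (y - z)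
    have n2 := cauchyBump_nonneg (hv₂0 y) (y - z)
    have n3 := cauchyBump_nonneg (hv₁0 z) (z - y)
    have n4 := cauchyBump_nonneg (hv₂0 z) (z - y)
    rw [e1, enorm_mul, enorm_mul, RCLike.enorm_conj]
    calc _ ≤ ‖G y‖ₑ * ‖G z‖ₑ * ENNReal.ofReal (C / (μ * |t|) *
          (cauchyBump (v₁ y) (y - z) + cauchyBump (v₂ y) (y - z) +
            (cauchyBump (v₁ z) (z - y) + cauchyBump (v₂ z) (z - y)))) := by
          gcongr
          rw [← ofReal_norm]
          exact ENNReal.ofReal_le_ofReal e3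
      _ = _ := by
          rw [ENNReal.ofReal_mul (by positivity), ENNReal.ofReal_add (by positivity) (by positivity),
            ENNReal.ofReal_add n1 n2, ENNReal.ofReal_add n3 n4]
          simp only [hk]
          ring
  calc _ ≤ ∫⁻ q : ℝ × ℝ, ENNReal.ofReal (C / (μ * |t|)) *
      (k v₁ q.1 q.2 + k v₂ q.1 q.2 + (k v₁ q.2 q.1 + k v₂ q.2 q.1)) := lintegral_mono hpt
    _ = ENNReal.ofReal (C / (μ * |t|)) * ((∫⁻ q : ℝ × ℝ, k v₁ q.1 q.2) +
        (∫⁻ q : ℝ × ℝ, k v₂ q.1 q.2) + ((∫⁻ q : ℝ × ℝ, k v₁ q.2 q.1) +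
          ∫⁻ q : ℝ × ℝ, k v₂ q.2 q.1)) := by
      have m1 := hkm v₁ hv₁m
      have m2 := hkm v₂ hv₂m
      have m3 := hkm' v₁ hv₁m
      have m12 : Measurable fun q : ℝ × ℝ => k v₁ q.1 q.2 + k v₂ q.1 q.2 := m1.add m2
      rw [lintegral_const_mul' _ _ ENNReal.ofReal_ne_top, lintegral_add_left m12,
        lintegral_add_left m1, lintegral_add_left m3]
    _ ≤ ENNReal.ofReal (C / (μ * |t|)) * ((ENNReal.ofReal (8 * Real.pi) * ∫⁻ y, ‖G y‖ₑ ^ 2) +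
        (ENNReal.ofReal (8 * Real.pi) * ∫⁻ y, ‖G y‖ₑ ^ 2) +
        ((ENNReal.ofReal (8 * Real.pi) * ∫⁻ y, ‖G y‖ₑ ^ 2) +
          ENNReal.ofReal (8 * Real.pi) * ∫⁻ y, ‖G y‖ₑ ^ 2)) := by
      have b1 := hkI v₁ hv₁m hv₁0 hv₁b
      have b2 := hkI v₂ hv₂m hv₂0 hv₂b
      have b3 := hkI' v₁ hv₁m hv₁0 hv₁b
      have b4 := hkI' v₂ hv₂m hv₂0 hv₂b
      gcongr
    _ = ENNReal.ofReal (C * (4 * (8 * Real.pi)) / (μ * |t|)) * ∫⁻ y, ‖G y‖ₑ ^ 2 := by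
      have : C * (4 * (8 * Real.pi)) / (μ * |t|) = C / (μ * |t|) * (4 * (8 * Real.pi)) := by ring
      rw [this, ENNReal.ofReal_mul (p := C / (μ * |t|)) (by positivity),
        ENNReal.ofReal_mul (p := 4) (by norm_num),
        ENNReal.ofReal_ofNat]
      ring

/-! ### The trilinear estimate on a trapezoid with good chords -/

/-- The shear `(u, y) ↦ (u - y, y)` of the plane. -/
def shear : ℝ × ℝ ≃ᵐ ℝ × ℝ where
  toFun p := (p.1 - p.2, p.2)
  invFun p := (p.1 + p.2, p.2)
  left_inv p := by simp
  right_inv p := by simp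
  measurable_toFun := by
    show Measurable fun p : ℝ × ℝ => (p.1 - p.2, p.2)
    fun_prop
  measurable_invFun := by
    show Measurable fun p : ℝ × ℝ => (p.1 + p.2, p.2)
    fun_prop

lemma measurePreserving_shear : MeasurePreserving shear volume volume :=
  measurePreserving_sub_prod (volume : Measure ℝ) (volume : Measure ℝ)

/-- The square of the `L²` norm, as an extended nonnegative real. -/
def energy (f : ℝ → ℂ) : ℝ≥0∞ := ∫⁻ x, ‖f x‖ₑ ^ 2

/-- The `L²` norms of the products `f(x) f̄(x + t)` are square integrable in `t`. -/
lemma lintegral_energy_mul_shift {f : ℝ → ℂ} (hf : Measurable f) :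
    ∫⁻ t, energy (fun x => f x * conj (f (x + t))) = energy f ^ 2 := by
  have h1 : ∀ t, energy (fun x => f x * conj (f (x + t))) =
      ∫⁻ x, ‖f x‖ₑ ^ 2 * ‖f (x + t)‖ₑ ^ 2 := by
    intro t
    refine lintegral_congr fun x => ?_
    rw [enorm_mul, RCLike.enorm_conj, mul_pow]
  simp only [h1]
  have hf' := hf.enorm
  rw [lintegral_lintegral_swap (by fun_prop)]
  have h2 : ∀ x, ∫⁻ t, ‖f x‖ₑ ^ 2 * ‖f (x + t)‖ₑ ^ 2 = ‖f x‖ₑ ^ 2 * energy f := by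
    intro x
    rw [lintegral_const_mul _ (by fun_prop)]
    congr 1
    exact lintegral_add_left_eq_self (fun t => ‖f t‖ₑ ^ 2) x
  simp only [h2]
  rw [lintegral_mul_const _ (by fun_prop), pow_two]
  rfl

lemma lintegral_energy_mul_shift_neg {g : ℝ → ℂ} (hg : Measurable g) :
    ∫⁻ t, energy (fun y => g y * conj (g (y - t))) = energy g ^ 2 := by
  rw [← lintegral_energy_mul_shift hg,
    ← lintegral_neg_eq_self (fun t => energy fun x => g x * conj (g (x + t)))]
  simp only [sub_eq_add_neg]

lemma measurable_energy_mul_shift {f : ℝ → ℂ} (hf : Measurable f) :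
    Measurable fun t => energy (fun x => f x * conj (f (x + t))) := by
  have h1 : ∀ t, energy (fun x => f x * conj (f (x + t))) =
      ∫⁻ x, ‖f x‖ₑ ^ 2 * ‖f (x + t)‖ₑ ^ 2 := by
    intro t
    refine lintegral_congr fun x => ?_
    rw [enorm_mul, RCLike.enorm_conj, mul_pow]
  simp only [h1]
  have hf' := hf.enorm
  exact Measurable.lintegral_prod_right' (f := fun q : ℝ × ℝ => ‖f q.2‖ₑ ^ 2 * ‖f (q.2 + q.1)‖ₑ ^ 2)
    (by fun_prop)

/-- The `L¹` norm of `f(x) f̄(x + t)` is at most `‖f‖₂²`. -/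
lemma lintegral_enorm_mul_shift_le {f : ℝ → ℂ} (hf : Measurable f) (t : ℝ) :
    ∫⁻ x, ‖f x * conj (f (x + t))‖ₑ ≤ energy f := by
  have hf' := hf.enorm
  have h := sq_lintegral_mul_le (μ := volume) (f := fun x => ‖f x‖ₑ) (g := fun x => ‖f (x + t)‖ₑ)
    hf'.aemeasurable (by fun_prop)
  rw [lintegral_add_right_eq_self (fun x => ‖f x‖ₑ ^ 2) t] at h
  simp only [enorm_mul, RCLike.enorm_conj]
  refine (ENNReal.pow_le_pow_left_iff two_ne_zero).mp ?_
  rw [pow_two (energy f)]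
  exact h

lemma lintegral_enorm_mul_shift_neg_le {g : ℝ → ℂ} (hg : Measurable g) (t : ℝ) :
    ∫⁻ y, ‖g y * conj (g (y - t))‖ₑ ≤ energy g := by
  simpa only [sub_eq_add_neg] using lintegral_enorm_mul_shift_le hg (-t)

lemma sq_rpow_half (x : ℝ≥0∞) : (x ^ (1 / 2 : ℝ)) ^ 2 = x := by
  rw [← ENNReal.rpow_two, ← ENNReal.rpow_mul]
  norm_num

/-- The trilinear estimate on a trapezoid with good chords. The function `h` is removed by the `TT*`
method; for the difference `t` of the two copies of `y`, the trivial bound is used when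
`|t| ≤ μ^{-1/3}` and the bilinear estimate otherwise. -/
lemma exists_enorm_trilinear_sq_le (n : ℕ) (A B : ℝ) (hA : 0 < A) (hB : 0 < B) :
    ∃ C : ℝ, 0 < C ∧ ∀ (S : MvPolynomial (Fin 2) ℝ), S.totalDegree ≤ n →
    ∀ (a b : ℝ) (α β : ℝ → ℝ) (φ : ℝ → ℝ → ℂ), IsAdapted a b α β φ B →
    ∀ μ : ℝ, 0 < μ → HasGoodChords a b α β S A μ →
    ∀ f g h : ℝ → ℂ, Measurable f → Measurable g → Measurable h → energy f ≠ ⊤ → energy g ≠ ⊤ →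
    ‖∫ p : ℝ × ℝ, Complex.exp (Complex.I * (evalXY S p.1 p.2 : ℂ)) * φ p.1 p.2 *
        (f p.1 * g p.2 * h (p.1 + p.2))‖ₑ ^ 2 ≤
      ENNReal.ofReal (C * μ ^ (-(1 / 3) : ℝ)) * (energy f * energy g * energy h) := by
  obtain ⟨C, hC, hbil⟩ := exists_enorm_bilinear_sq_le n A B hA hB
  refine ⟨2 * B ^ 2 + C ^ (1 / 2 : ℝ), by positivity, ?_⟩
  intro S hS a b α β φ hφ μ hμ hH f g h hf hg hh hfE hgE
  -- the amplitude vanishes unless `y ∈ (a, b)`, so `g` may be assumed to be supported there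
  wlog hgs : ∀ y ∉ Set.Ioo a b, g y = 0 generalizing g
  · set g' := (Set.Ioo a b).indicator g with hgdef
    have hgg : energy g' ≤ energy g := by
      refine lintegral_mono fun y => ?_
      simp only [hgdef]
      gcongr
      exact enorm_indicator_le_enorm_self _ _
    have h1 := this g' (hg.indicator measurableSet_Ioo) (ne_top_of_le_ne_top hgE hgg)
      (fun y hy => Set.indicator_of_notMem hy _)
    have h2 : ∀ p : ℝ × ℝ, Complex.exp (Complex.I * (evalXY S p.1 p.2 : ℂ)) * φ p.1 p.2 *
        (f p.1 * g' p.2 * h (p.1 + p.2)) = Complex.exp (Complex.I * (evalXY S p.1 p.2 : ℂ)) *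
        φ p.1 p.2 * (f p.1 * g p.2 * h (p.1 + p.2)) := by
      intro p
      by_cases hp : p.2 ∈ Set.Ioo a b
      · simp only [hgdef, Set.indicator_of_mem hp]
      · rw [hφ.eq_zero p.1 p.2 fun h => hp h.1]; simp
    simp only [h2] at h1
    exact h1.trans (by gcongr)
  have hφm := hφ.measurable
  set w : ℝ → ℝ → ℂ := fun u y =>
    Complex.exp (Complex.I * (evalXY S (u - y) y : ℂ)) * φ (u - y) y * (f (u - y) * g y) with hw
  have hwm : Measurable fun p : ℝ × ℝ => w p.1 p.2 := by
    have m1 : Measurable fun p : ℝ × ℝ => evalXY S (p.1 - p.2) p.2 :=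
      (continuous_evalXY (continuous_fst.sub continuous_snd) continuous_snd S).measurable
    have m2 : Measurable fun p : ℝ × ℝ => φ (p.1 - p.2) p.2 :=
      hφm.comp (by fun_prop : Measurable fun p : ℝ × ℝ => (p.1 - p.2, p.2))
    have m3 : Measurable fun p : ℝ × ℝ => f (p.1 - p.2) * g p.2 := by fun_prop
    exact ((measurable_exp_I_mul m1).mul m2).mul m3
  have hwu : ∀ x y, w (x + y) y =
      Complex.exp (Complex.I * (evalXY S x y : ℂ)) * φ x y * (f x * g y) := by
    intro x y
    simp only [hw, add_sub_cancel_right]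
  have hφe : ∀ x y, ‖φ x y‖ₑ ≤ ENNReal.ofReal B := fun x y => by
    rw [← ofReal_norm]; exact ENNReal.ofReal_le_ofReal (hφ.norm_le hB.le x y)
  -- Cauchy–Schwarz, to remove `h`
  have hCS : ‖∫ p : ℝ × ℝ, Complex.exp (Complex.I * (evalXY S p.1 p.2 : ℂ)) * φ p.1 p.2 *
      (f p.1 * g p.2 * h (p.1 + p.2))‖ₑ ^ 2 ≤ energy h * ∫⁻ u, ‖∫ y, w u y‖ₑ ^ 2 := by
    have e1 : ∀ p : ℝ × ℝ, Complex.exp (Complex.I * (evalXY S p.1 p.2 : ℂ)) * φ p.1 p.2 *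
        (f p.1 * g p.2 * h (p.1 + p.2)) =
        (fun q : ℝ × ℝ => h q.1 * w q.1 q.2) (shear.symm p) := by
      intro p
      show _ = h (p.1 + p.2) * w (p.1 + p.2) p.2
      rw [hwu]; ring
    simp only [e1]
    rw [measurePreserving_shear.symm.integral_comp' (fun q : ℝ × ℝ => h q.1 * w q.1 q.2)]
    by_cases hi : Integrable fun p : ℝ × ℝ => h p.1 * w p.1 p.2
    · have h1 : ∫ p : ℝ × ℝ, h p.1 * w p.1 p.2 = ∫ u, h u * ∫ y, w u y := by
        rw [Measure.volume_eq_prod, integral_prod _ hi]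
        simp only [integral_const_mul]
      have hTm : StronglyMeasurable fun u => ∫ y, w u y :=
        hwm.stronglyMeasurable.integral_prod_right'
      rw [h1]
      refine (pow_le_pow_left' (enorm_integral_le_lintegral_enorm _) 2).trans ?_
      simp only [enorm_mul]
      exact sq_lintegral_mul_le hh.enorm.aemeasurable hTm.measurable.enorm.aemeasurable
    · -- the integral is `0` by convention, so there is nothing to prove
      rw [integral_undef hi]
      simp
  have hfin : ∫⁻ u, (∫⁻ y, ‖w u y‖ₑ) ^ 2 ≠ ⊤ := by
    have hf' := hf.enorm
    have hg' := hg.enorm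
    have h1 : ∀ u, (∫⁻ y, ‖w u y‖ₑ) ^ 2 ≤ ENNReal.ofReal B ^ 2 *
        ((∫⁻ y, (‖f (u - y)‖ₑ * ‖g y‖ₑ) ^ 2) * ENNReal.ofReal (b - a)) := by
      intro u
      have h2 : ∫⁻ y, ‖w u y‖ₑ ≤ ENNReal.ofReal B *
          ∫⁻ y, ‖f (u - y)‖ₑ * ‖g y‖ₑ * (Set.Ioo a b).indicator 1 y := by
        rw [← lintegral_const_mul' _ _ ENNReal.ofReal_ne_top]
        refine lintegral_mono fun y => ?_
        simp only [hw, enorm_mul, enorm_exp_I_mul, one_mul]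
        refine mul_le_mul' (hφe _ _) ?_
        · by_cases hy : y ∈ Set.Ioo a b
          · simp [hy]
          · simp [show g y = 0 from hgs y hy]
      refine (pow_le_pow_left' h2 2).trans ?_
      rw [mul_pow]
      gcongr
      refine (sq_lintegral_mul_le (by fun_prop)
        (measurable_one.indicator measurableSet_Ioo).aemeasurable).trans (le_of_eq ?_)
      congr 1
      have : ∀ y, (Set.Ioo a b).indicator (1 : ℝ → ℝ≥0∞) y ^ 2 = (Set.Ioo a b).indicator 1 y := by
        intro y
        by_cases hy : y ∈ Set.Ioo a b <;> simp [hy]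
      simp only [this]
      rw [lintegral_indicator_one measurableSet_Ioo, Real.volume_Ioo]
    refine ne_top_of_le_ne_top ?_ (lintegral_mono h1)
    have h3 : ∫⁻ u, ∫⁻ y, (‖f (u - y)‖ₑ * ‖g y‖ₑ) ^ 2 = energy f * energy g := by
      rw [lintegral_lintegral_swap (by fun_prop)]
      have h4 : ∀ y, ∫⁻ u, (‖f (u - y)‖ₑ * ‖g y‖ₑ) ^ 2 = energy f * ‖g y‖ₑ ^ 2 := by
        intro y
        simp only [mul_pow]
        rw [lintegral_mul_const _ (by fun_prop),
          lintegral_sub_right_eq_self (fun x => ‖f x‖ₑ ^ 2) y]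
        rfl
      simp only [h4]
      rw [lintegral_const_mul _ (by fun_prop)]
      rfl
    rw [lintegral_const_mul' _ _ (ENNReal.pow_ne_top ENNReal.ofReal_ne_top),
      lintegral_mul_const' _ _ ENNReal.ofReal_ne_top, h3]
    exact ENNReal.mul_ne_top (ENNReal.pow_ne_top ENNReal.ofReal_ne_top)
      (ENNReal.mul_ne_top (ENNReal.mul_ne_top hfE hgE) ENNReal.ofReal_ne_top)
  set F : ℝ → ℝ → ℂ := fun t x => f x * conj (f (x + t)) with hF
  set G : ℝ → ℝ → ℂ := fun t y => g y * conj (g (y - t)) with hG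
  have hFm : ∀ t, Measurable (F t) := fun t =>
    hf.mul (Complex.continuous_conj.measurable.comp (hf.comp (measurable_add_const t)))
  have hGm : ∀ t, Measurable (G t) := fun t =>
    hg.mul (Complex.continuous_conj.measurable.comp (hg.comp (measurable_sub_const t)))
  -- back in the coordinates `(x, y)`, the bilinear form in `F t` and `G t`
  have hB' : ∀ t, ∫ p : ℝ × ℝ, w p.1 p.2 * conj (w p.1 (p.2 - t)) =
      ∫ p : ℝ × ℝ, Complex.exp (Complex.I * (phaseDiff S t p.1 p.2 : ℂ)) * ampDiff φ t p.1 p.2 *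
        (F t p.1 * G t p.2) := by
    intro t
    rw [← measurePreserving_shear.symm.integral_comp'
      (fun p : ℝ × ℝ => w p.1 p.2 * conj (w p.1 (p.2 - t)))]
    refine integral_congr_ae (Filter.Eventually.of_forall fun p => ?_)
    show w (p.1 + p.2) p.2 * conj (w (p.1 + p.2) (p.2 - t)) = _
    have e1 : p.1 + p.2 = (p.1 + t) + (p.2 - t) := by ring
    rw [hwu, e1, hwu]
    have e2 : Complex.exp (Complex.I * (phaseDiff S t p.1 p.2 : ℂ)) =
        Complex.exp (Complex.I * (evalXY S p.1 p.2 : ℂ)) *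
        conj (Complex.exp (Complex.I * (evalXY S (p.1 + t) (p.2 - t) : ℂ))) := by
      rw [← Complex.exp_conj, ← Complex.exp_add]
      congr 1
      simp [phaseDiff]
      ring
    simp only [e2, hF, hG, ampDiff, map_mul]
    ring
  set I : ℝ → ℝ≥0∞ := fun t => ‖∫ p : ℝ × ℝ, w p.1 p.2 * conj (w p.1 (p.2 - t))‖ₑ with hI
  have htriv : ∀ t, I t ≤ ENNReal.ofReal (B ^ 2) * (energy f * energy g) := by
    intro t
    simp only [hI, hB']
    refine (enorm_integral_le_lintegral_enorm _).trans ?_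
    calc _ ≤ ∫⁻ p : ℝ × ℝ, ENNReal.ofReal (B ^ 2) * (‖F t p.1‖ₑ * ‖G t p.2‖ₑ) := by
          refine lintegral_mono fun p => ?_
          simp only [enorm_mul, enorm_exp_I_mul, one_mul]
          gcongr
          rw [ampDiff, enorm_mul, RCLike.enorm_conj, pow_two, ENNReal.ofReal_mul hB.le]
          gcongr <;> exact hφe _ _
      _ = ENNReal.ofReal (B ^ 2) * ((∫⁻ x, ‖F t x‖ₑ) * ∫⁻ y, ‖G t y‖ₑ) := by
          rw [lintegral_const_mul' _ _ ENNReal.ofReal_ne_top, Measure.volume_eq_prod,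
            lintegral_prod_mul (hFm t).enorm.aemeasurable (hGm t).enorm.aemeasurable]
      _ ≤ _ := by
          gcongr
          · exact lintegral_enorm_mul_shift_le hf t
          · exact lintegral_enorm_mul_shift_neg_le hg t
  -- the threshold at which the two bounds for `I t` balance: `μ t₀³ = 1`
  set t₀ : ℝ := μ ^ (-(1 / 3) : ℝ) with ht₀
  have ht₀pos : 0 < t₀ := by positivity
  have hlarge : ∀ t, t₀ < |t| → I t ≤ ENNReal.ofReal (C ^ (1 / 2 : ℝ) * t₀) *
      (energy (F t) ^ (1 / 2 : ℝ) * energy (G t) ^ (1 / 2 : ℝ)) := by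
    intro t ht
    have ht' : 0 < |t| := ht₀pos.trans ht
    refine (ENNReal.pow_le_pow_left_iff two_ne_zero).mp ?_
    simp only [hI, hB']
    refine (hbil S hS a b α β φ hφ μ hμ hH t (abs_pos.mp ht') (F t) (G t) (hFm t) (hGm t)
      (ne_top_of_le_ne_top hgE (lintegral_enorm_mul_shift_neg_le hg t))).trans ?_
    rw [mul_pow, mul_pow, sq_rpow_half, sq_rpow_half,
      ← ENNReal.ofReal_pow (by positivity)]
    refine mul_le_mul_left (ENNReal.ofReal_le_ofReal ?_) _
    have e1 : (C ^ (1 / 2 : ℝ) * t₀) ^ 2 = C * t₀ ^ 2 := by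
      rw [mul_pow, ← Real.rpow_natCast (C ^ (1 / 2 : ℝ)) 2, ← Real.rpow_mul hC.le]
      norm_num
    have e2 : μ * t₀ ^ 3 = 1 := by
      rw [ht₀, ← Real.rpow_natCast (μ ^ (-(1 / 3) : ℝ)) 3, ← Real.rpow_mul hμ.le]
      norm_num
      rw [Real.rpow_neg_one, mul_inv_cancel₀ hμ.ne']
    rw [e1, div_le_iff₀ (by positivity)]
    calc C = C * (μ * t₀ ^ 3) := by rw [e2, mul_one]
      _ = C * t₀ ^ 2 * (μ * t₀) := by ring
      _ ≤ C * t₀ ^ 2 * (μ * |t|) := by gcongr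
  have hFE : Measurable fun t => energy (F t) := measurable_energy_mul_shift hf
  have hGE : Measurable fun t => energy (G t) := by
    have := (measurable_energy_mul_shift hg).comp measurable_neg
    simpa only [Function.comp_def, ← sub_eq_add_neg] using this
  have hsqrt : ∫⁻ t, energy (F t) ^ (1 / 2 : ℝ) * energy (G t) ^ (1 / 2 : ℝ) ≤
      energy f * energy g := by
    refine (ENNReal.pow_le_pow_left_iff two_ne_zero).mp ?_
    refine (sq_lintegral_mul_le (hFE.pow_const _).aemeasurable
      (hGE.pow_const _).aemeasurable).trans (le_of_eq ?_)
    simp only [sq_rpow_half]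
    rw [mul_pow, lintegral_energy_mul_shift hf, lintegral_energy_mul_shift_neg hg]
  have hII : ∫⁻ t, I t ≤ ENNReal.ofReal ((2 * B ^ 2 + C ^ (1 / 2 : ℝ)) * t₀) *
      (energy f * energy g) := by
    calc ∫⁻ t, I t ≤ ∫⁻ t, ((Set.Icc (-t₀) t₀).indicator
          (fun _ => ENNReal.ofReal (B ^ 2) * (energy f * energy g)) t +
          ENNReal.ofReal (C ^ (1 / 2 : ℝ) * t₀) *
          (energy (F t) ^ (1 / 2 : ℝ) * energy (G t) ^ (1 / 2 : ℝ))) := by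
          refine lintegral_mono fun t => ?_
          by_cases ht : t ∈ Set.Icc (-t₀) t₀
          · rw [Set.indicator_of_mem ht]
            exact (htriv t).trans le_self_add
          · refine (hlarge t ?_).trans le_add_self
            rw [Set.mem_Icc, ← abs_le, not_le] at ht
            exact ht
      _ = ENNReal.ofReal (B ^ 2) * (energy f * energy g) * ENNReal.ofReal (2 * t₀) +
          ENNReal.ofReal (C ^ (1 / 2 : ℝ) * t₀) *
          ∫⁻ t, energy (F t) ^ (1 / 2 : ℝ) * energy (G t) ^ (1 / 2 : ℝ) := by
          rw [lintegral_add_left (measurable_const.indicator measurableSet_Icc),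
            lintegral_indicator measurableSet_Icc, setLIntegral_const, Real.volume_Icc,
            lintegral_const_mul' _ _ ENNReal.ofReal_ne_top]
          congr 3
          ring
      _ ≤ ENNReal.ofReal (B ^ 2) * (energy f * energy g) * ENNReal.ofReal (2 * t₀) +
          ENNReal.ofReal (C ^ (1 / 2 : ℝ) * t₀) * (energy f * energy g) := by gcongr
      _ = _ := by
          have e1 : (2 * B ^ 2 + C ^ (1 / 2 : ℝ)) * t₀ =
              B ^ 2 * (2 * t₀) + C ^ (1 / 2 : ℝ) * t₀ := by ring
          rw [e1, ENNReal.ofReal_add (by positivity) (by positivity),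
            ENNReal.ofReal_mul (p := B ^ 2) (by positivity)]
          ring
  calc _ ≤ energy h * ∫⁻ u, ‖∫ y, w u y‖ₑ ^ 2 := hCS
    _ ≤ energy h * ∫⁻ t, I t :=
      mul_le_mul' le_rfl (lintegral_enorm_integral_sq_le_diff hwm hfin)
    _ ≤ energy h * (ENNReal.ofReal ((2 * B ^ 2 + C ^ (1 / 2 : ℝ)) * t₀) *
        (energy f * energy g)) := by gcongr
    _ = _ := by ring

/-! ### Amplitudes given by smooth functions -/

/-- A continuous function supported in a closed interval vanishes also at the endpoints. -/
lemma eq_zero_of_support_subset_Icc {E : Type*} [NormedAddCommGroup E] {g : ℝ → E}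
    (hg : Continuous g) {l r : ℝ} (h : Function.support g ⊆ Set.Icc l r) {x : ℝ}
    (hx : x ∉ Set.Ioo l r) : g x = 0 := by
  have h1 : Set.EqOn g (fun _ => 0) (Set.Icc l r)ᶜ := fun z hz =>
    Function.notMem_support.mp fun h' => hz (h h')
  refine h1.closure hg continuous_const ?_
  rw [closure_compl, interior_Icc]
  exact hx

lemma sectionLength_trapezoid {a b : ℝ} {α β : ℝ → ℝ} (h : IsTrapezoidData a b α β) {y : ℝ}
    (hy : y ∈ Set.Ioo a b) : sectionLength (trapezoid a b α β) y = β y - α y := by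
  have h1 : {x : ℝ | (x, y) ∈ trapezoid a b α β} = Set.Ioo (α y) (β y) := by
    ext x
    exact ⟨fun h => h.2, fun h => ⟨hy, h⟩⟩
  rw [sectionLength, h1, Real.volume_real_Ioo_of_le (h.left_lt_right y hy).le]

lemma measurableSet_trapezoid {a b : ℝ} {α β : ℝ → ℝ} (h : IsTrapezoidData a b α β) :
    MeasurableSet (trapezoid a b α β) := by
  classical
  have hα : Measurable ((Set.Icc a b).piecewise α 0) :=
    h.continuousOn_left.measurable_piecewise continuousOn_const measurableSet_Icc
  have hβ : Measurable ((Set.Icc a b).piecewise β 0) :=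
    h.continuousOn_right.measurable_piecewise continuousOn_const measurableSet_Icc
  have h1 : trapezoid a b α β = {p : ℝ × ℝ | p.2 ∈ Set.Ioo a b} ∩
      ({p : ℝ × ℝ | (Set.Icc a b).piecewise α 0 p.2 < p.1} ∩
      {p : ℝ × ℝ | p.1 < (Set.Icc a b).piecewise β 0 p.2}) := by
    ext p
    simp only [trapezoid, Set.mem_ofPred_eq, Set.mem_inter_iff]
    refine and_congr_right fun hp => ?_
    rw [Set.piecewise_eq_of_mem _ _ _ (Set.Ioo_subset_Icc_self hp),
      Set.piecewise_eq_of_mem _ _ _ (Set.Ioo_subset_Icc_self hp), Set.mem_Ioo]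
  rw [h1]
  exact (measurable_snd measurableSet_Ioo).inter
    ((measurableSet_lt (hα.comp measurable_snd) measurable_fst).inter
      (measurableSet_lt measurable_fst (hβ.comp measurable_snd)))

/-- Cutting a sectionwise smooth amplitude off outside the trapezoid does not spoil its smoothness,
because each of its sections vanishes to infinite order at the ends of the section. -/
lemma isAdapted_indicator {a b : ℝ} {α β : ℝ → ℝ} (h : IsTrapezoidData a b α β) {φ : ℝ → ℝ → ℂ}
    (hφ : Measurable fun p : ℝ × ℝ => φ p.1 p.2) {B : ℝ}
    (hsm : ∀ y ∈ Set.Ioo a b, ContDiff ℝ ∞ (fun x => φ x y) ∧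
      tsupport (fun x => φ x y) ⊆ Set.Icc (α y) (β y))
    (hB : ∀ p ∈ trapezoid a b α β, ∑ k ∈ Finset.range 3,
      sectionLength (trapezoid a b α β) p.2 ^ k * ‖iteratedDeriv k (fun x => φ x p.2) p.1‖ ≤ B) :
    IsAdapted a b α β
      (fun x y => (trapezoid a b α β).indicator (fun p => φ p.1 p.2) (x, y)) B where
  data := h
  measurable := hφ.indicator (measurableSet_trapezoid h)
  eq_zero x y hxy := Set.indicator_of_notMem (s := trapezoid a b α β) (a := (x, y)) hxy _
  bound y hy := by
    obtain ⟨hs, ht⟩ := hsm y hy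
    have hlt := h.left_lt_right y hy
    have hL : 0 < β y - α y := sub_pos.mpr hlt
    set f : ℝ → ℂ := fun x => φ x y with hf
    have hs1 : ContDiff ℝ ∞ (deriv f) := (contDiff_infty_iff_deriv.mp hs).2
    have hs2 : ContDiff ℝ ∞ (deriv (deriv f)) := (contDiff_infty_iff_deriv.mp hs1).2
    have ht0 : Function.support f ⊆ Set.Icc (α y) (β y) := (subset_tsupport f).trans ht
    have ht1 : tsupport (deriv f) ⊆ Set.Icc (α y) (β y) :=
      (closure_minimal support_deriv_subset (isClosed_tsupport f)).trans ht
    have ht2 : Function.support (deriv (deriv f)) ⊆ Set.Icc (α y) (β y) :=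
      support_deriv_subset.trans ht1
    have hψ : (fun x => (trapezoid a b α β).indicator (fun p => φ p.1 p.2) (x, y)) = f := by
      ext x
      by_cases hx : x ∈ Set.Ioo (α y) (β y)
      · exact Set.indicator_of_mem (show (x, y) ∈ trapezoid a b α β from ⟨hy, hx⟩) _
      · rw [Set.indicator_of_notMem (fun h' => hx h'.2),
          eq_zero_of_support_subset_Icc hs.continuous ht0 hx]
    have hB0 : 0 ≤ B := by
      refine le_trans (Finset.sum_nonneg fun k _ => ?_)
        (hB ((α y + β y) / 2, y) ⟨hy, by dsimp only; linarith, by dsimp only; linarith⟩)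
      exact mul_nonneg (pow_nonneg measureReal_nonneg _) (norm_nonneg _)
    have key : ∀ k ∈ Finset.range 3, ∀ x ∈ Set.Ioo (α y) (β y),
        ‖iteratedDeriv k f x‖ ≤ B / (β y - α y) ^ k := by
      intro k hk x hx
      have h1 := hB (x, y) ⟨hy, hx⟩
      rw [sectionLength_trapezoid h hy] at h1
      rw [le_div_iff₀ (pow_pos hL k), mul_comm]
      refine le_trans ?_ h1
      exact Finset.single_le_sum (f := fun k => (β y - α y) ^ k * ‖iteratedDeriv k f x‖)
        (fun i _ => mul_nonneg (pow_nonneg hL.le _) (norm_nonneg _)) hk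
    have out : ∀ {g : ℝ → ℂ} {c : ℝ}, Continuous g → Function.support g ⊆ Set.Icc (α y) (β y) →
        0 ≤ c → (∀ x ∈ Set.Ioo (α y) (β y), ‖g x‖ ≤ c) → ∀ x, ‖g x‖ ≤ c := by
      intro g c hg hsupp hc hle x
      by_cases hx : x ∈ Set.Ioo (α y) (β y)
      · exact hle x hx
      · rw [eq_zero_of_support_subset_Icc hg hsupp hx, norm_zero]
        exact hc
    have k0 := key 0 (by simp)
    have k1 := key 1 (by simp)
    have k2 := key 2 (by simp)
    simp only [iteratedDeriv_zero, pow_zero, div_one] at k0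
    simp only [iteratedDeriv_one, pow_one] at k1
    simp only [iteratedDeriv_succ, iteratedDeriv_zero] at k2
    refine ⟨deriv f, deriv (deriv f), ?_⟩
    rw [hψ]
    exact
      { deriv₁ := fun x => (hs.differentiable (by simp) x).hasDerivAt
        deriv₂ := fun x => (hs1.differentiable (by simp) x).hasDerivAt
        cont := hs2.continuous
        bound₀ := fun x _ => out hs.continuous ht0 hB0 k0 x
        bound₁ := fun x _ => out hs1.continuous ((subset_tsupport _).trans ht1) (by positivity) k1 x
        bound₂ := fun x _ => out hs2.continuous ht2 (by positivity) k2 x }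

/-! ### Cutting a trapezoid into pieces with good chords -/

/-- The part of the amplitude `φ` over `(a, b)`. -/
def slab (φ : ℝ → ℝ → ℂ) (a b : ℝ) (x y : ℝ) : ℂ :=
  (Set.Ioo a b).indicator (fun y => φ x y) y

lemma IsAdapted.slab {a b : ℝ} {α β : ℝ → ℝ} {φ : ℝ → ℝ → ℂ} {B : ℝ} (h : IsAdapted a b α β φ B)
    {a' b' : ℝ} (ha : a ≤ a') (hlt : a' < b') (hb : b' ≤ b) :
    IsAdapted a' b' α β (slab φ a' b') B where
  data :=
    { lt := hlt
      continuousOn_left := h.data.continuousOn_left.mono (Set.Icc_subset_Icc ha hb)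
      continuousOn_right := h.data.continuousOn_right.mono (Set.Icc_subset_Icc ha hb)
      monotone_left := h.data.monotone_left.imp
        (fun h => h.mono (Set.Icc_subset_Icc ha hb)) fun h => h.mono (Set.Icc_subset_Icc ha hb)
      monotone_right := h.data.monotone_right.imp
        (fun h => h.mono (Set.Icc_subset_Icc ha hb)) fun h => h.mono (Set.Icc_subset_Icc ha hb)
      left_lt_right := fun y hy => h.data.left_lt_right y (Set.Ioo_subset_Ioo ha hb hy) }
  measurable := h.measurable.indicator (measurable_snd (measurableSet_Ioo (a := a') (b := b')))
  eq_zero x y hxy := by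
    by_cases hy : y ∈ Set.Ioo a' b'
    · rw [TrilinearVdC.slab, Set.indicator_of_mem hy]
      exact h.eq_zero x y fun h' => hxy ⟨hy, h'.2⟩
    · exact Set.indicator_of_notMem hy _
  bound y hy := by
    have h1 : (fun x => TrilinearVdC.slab φ a' b' x y) = fun x => φ x y :=
      funext fun x => Set.indicator_of_mem hy _
    rw [h1]
    exact h.bound y (Set.Ioo_subset_Ioo ha hb hy)

/-- Off finitely many heights, whose number depends only on the degree, the bounds on `H` over the
trapezoid persist, with a loss of `2`, on all antidiagonal chords. They are encoded in the
positivity of the single polynomial `(H² - μ²/4)(4A²μ² - H²)`. -/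
lemma exists_finset_hasGoodChords {n : ℕ} {A μ : ℝ} (hA : 1 ≤ A) (hμ : 0 < μ)
    {S : MvPolynomial (Fin 2) ℝ} (hS : S.totalDegree ≤ n) {a b : ℝ} {α β : ℝ → ℝ}
    (h : IsTrapezoidData a b α β)
    (hH : ∀ p ∈ trapezoid a b α β,
      μ ≤ |evalXY (mixedH S) p.1 p.2| ∧ |evalXY (mixedH S) p.1 p.2| ≤ A * μ) :
    ∃ F : Finset ℝ, F.card ≤ (2 * (4 * n) + 1) * (4 * n) ∧
      ∀ a' b', a ≤ a' → b' ≤ b → (∀ z ∈ F, z ∉ Set.Ioo a' b') → HasGoodChords a' b' α β S A μ := by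
  set Q := mixedH S with hQ
  set E : MvPolynomial (Fin 2) ℝ := (Q * Q - MvPolynomial.C (μ ^ 2 / 4)) *
    (MvPolynomial.C (4 * A ^ 2 * μ ^ 2) - Q * Q) with hE
  have hQd : (Q * Q).totalDegree ≤ n + n := (MvPolynomial.totalDegree_mul _ _).trans
    (add_le_add ((totalDegree_mixedH_le S).trans hS) ((totalDegree_mixedH_le S).trans hS))
  have hEd : E.totalDegree ≤ 4 * n := by
    refine (MvPolynomial.totalDegree_mul _ _).trans ?_
    have e1 := MvPolynomial.totalDegree_sub (Q * Q) (MvPolynomial.C (μ ^ 2 / 4))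
    have e2 := MvPolynomial.totalDegree_sub (MvPolynomial.C (4 * A ^ 2 * μ ^ 2)) (Q * Q)
    rw [MvPolynomial.totalDegree_C] at e1 e2
    simp only [zero_le, sup_of_le_left, sup_of_le_right] at e1 e2
    omega
  have hEv : ∀ x y, evalXY E x y = (evalXY Q x y ^ 2 - μ ^ 2 / 4) *
      (4 * A ^ 2 * μ ^ 2 - evalXY Q x y ^ 2) := by
    intro x y
    simp only [hE, evalXY_mul, evalXY_sub, evalXY_C, pow_two]
  obtain ⟨F, hF, hgood⟩ := exists_finset_chord_pos hEd (κ := 3 / 4 * μ ^ 2 * (3 * A ^ 2 * μ ^ 2))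
    (by positivity) h (by
      intro x y hy hx
      obtain ⟨h1, h2⟩ := hH (x, y) ⟨hy, hx⟩
      dsimp only at h1 h2
      have h3 : μ ^ 2 ≤ evalXY Q x y ^ 2 := by
        rw [← sq_abs (evalXY Q x y)]
        gcongr
      have h4 : evalXY Q x y ^ 2 ≤ A ^ 2 * μ ^ 2 := by
        rw [← sq_abs (evalXY Q x y), ← mul_pow]
        gcongr
      rw [hEv]
      refine mul_le_mul ?_ ?_ (by positivity) ?_ <;> nlinarith [sq_nonneg μ])
  refine ⟨F, hF, ?_⟩
  intro a' b' ha hb hfree x y t hxy hxy' η hη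
  have sub := Set.Ioo_subset_Ioo ha hb
  have hpos : 0 < evalXY E (x + η) (y - η) := by
    have e : x + η = (x + y) - (y - η) := by ring
    rw [e]
    have avoid : ∀ y₁ y₂, y₁ ∈ Set.Ioo a' b' → y₂ ∈ Set.Ioo a' b' →
        ∀ z ∈ F, z ∉ Set.Icc y₁ y₂ := fun y₁ y₂ h1 h2 z hz hz' =>
      hfree z hz ⟨h1.1.trans_le hz'.1, hz'.2.trans_lt h2.2⟩
    have p1 : (x + y) - y ∈ Set.Ioo (α y) (β y) := by
      rw [add_sub_cancel_right]; exact hxy.2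
    have p2 : (x + y) - (y - t) ∈ Set.Ioo (α (y - t)) (β (y - t)) := by
      rw [show (x + y) - (y - t) = x + t by ring]; exact hxy'.2
    rcases le_total 0 t with ht | ht
    · rw [Set.uIcc_of_le ht] at hη
      exact hgood (y - t) y (x + y) (avoid _ _ hxy'.1 hxy.1) (sub hxy'.1) p2 (sub hxy.1) p1 _
        ⟨by linarith [hη.2], by linarith [hη.1]⟩
    · rw [Set.uIcc_of_ge ht] at hη
      exact hgood y (y - t) (x + y) (avoid _ _ hxy.1 hxy'.1) (sub hxy.1) p1 (sub hxy'.1) p2 _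
        ⟨by linarith [hη.2], by linarith [hη.1]⟩
  rw [hEv] at hpos
  set v := evalXY Q (x + η) (y - η) with hv
  have hAμ : μ ^ 2 ≤ A ^ 2 * μ ^ 2 := le_mul_of_one_le_left (sq_nonneg μ) (one_le_pow₀ hA)
  -- the two factors cannot both be negative
  have h12 : 0 < v ^ 2 - μ ^ 2 / 4 ∧ 0 < 4 * A ^ 2 * μ ^ 2 - v ^ 2 := by
    rcases mul_pos_iff.mp hpos with h | h
    · exact h
    · nlinarith [sq_nonneg μ]
  constructor
  · refine le_of_lt (lt_of_pow_lt_pow_left₀ 2 (abs_nonneg v) ?_)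
    rw [sq_abs]
    linarith [h12.1]
  · refine le_of_lt (lt_of_pow_lt_pow_left₀ 2 (by positivity) ?_)
    rw [sq_abs]
    linarith [h12.2]

/-- The trilinear integrand with the oscillating factor `exp(iS)` and the amplitude `φ`. -/
def trilinearIntegrand (S : MvPolynomial (Fin 2) ℝ) (φ : ℝ → ℝ → ℂ) (f g h : ℝ → ℂ) (p : ℝ × ℝ) : ℂ :=
  Complex.exp (Complex.I * (evalXY S p.1 p.2 : ℂ)) * φ p.1 p.2 * (f p.1 * g p.2 * h (p.1 + p.2))

lemma integrable_trilinearIntegrand {a b : ℝ} {α β : ℝ → ℝ} {φ : ℝ → ℝ → ℂ} {B : ℝ} (hB : 0 ≤ B)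
    (hφ : IsAdapted a b α β φ B) (S : MvPolynomial (Fin 2) ℝ) {f g h : ℝ → ℂ} (hf : Measurable f)
    (hg : Measurable g) (hh : Measurable h) (hfe : energy f ≠ ⊤) (hge : energy g ≠ ⊤)
    (hhe : energy h ≠ ⊤) : Integrable (trilinearIntegrand S φ f g h) := by
  have hS : Measurable fun p : ℝ × ℝ => evalXY S p.1 p.2 :=
    (continuous_evalXY continuous_fst continuous_snd S).measurable
  have hm : Measurable (trilinearIntegrand S φ f g h) :=
    ((measurable_exp_I_mul hS).mul hφ.measurable).mul
      (((hf.comp measurable_fst).mul (hg.comp measurable_snd)).mul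
        (hh.comp (measurable_fst.add measurable_snd)))
  refine ⟨hm.aestronglyMeasurable, ?_⟩
  have hpt : ∀ x y, ‖trilinearIntegrand S φ f g h (x, y)‖ₑ ≤
      (Set.Ioo a b).indicator (fun y => ENNReal.ofReal B * ‖g y‖ₑ) y *
        (‖f x‖ₑ * ‖h (x + y)‖ₑ) := by
    intro x y
    by_cases hy : y ∈ Set.Ioo a b
    · rw [Set.indicator_of_mem hy, trilinearIntegrand]
      dsimp only
      simp only [enorm_mul]
      rw [enorm_exp_I_mul, one_mul]
      have h1 : ‖φ x y‖ₑ ≤ ENNReal.ofReal B := by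
        rw [← ofReal_norm]
        exact ENNReal.ofReal_le_ofReal (hφ.norm_le hB x y)
      calc ‖φ x y‖ₑ * (‖f x‖ₑ * ‖g y‖ₑ * ‖h (x + y)‖ₑ)
          ≤ ENNReal.ofReal B * (‖f x‖ₑ * ‖g y‖ₑ * ‖h (x + y)‖ₑ) := by gcongr
        _ = _ := by ring
    · have h0 : trilinearIntegrand S φ f g h (x, y) = 0 := by
        rw [trilinearIntegrand]
        dsimp only
        rw [hφ.eq_zero x y fun h => hy h.1, mul_zero, zero_mul]
      rw [h0, enorm_zero]
      exact zero_le
  set G : ℝ → ℝ≥0∞ := (Set.Ioo a b).indicator (fun y => ENNReal.ofReal B * ‖g y‖ₑ) with hG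
  have hGm : Measurable G := (hg.enorm.const_mul _).indicator measurableSet_Ioo
  have hfm := hf.enorm
  have hhm := hh.enorm
  -- Cauchy-Schwarz in `x` for each height `y`
  have hCS : ∀ y, ∫⁻ x, ‖f x‖ₑ * ‖h (x + y)‖ₑ ≤ (energy f * energy h) ^ (1 / 2 : ℝ) := by
    intro y
    have h1 := sq_lintegral_mul_le (μ := volume) hf.enorm.aemeasurable
      (hh.comp (measurable_id.add_const y)).enorm.aemeasurable
    have h2 : ∫⁻ x, ‖(h ∘ fun x => id x + y) x‖ₑ ^ 2 = energy h :=
      lintegral_add_right_eq_self (fun x => ‖h x‖ₑ ^ 2) y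
    rw [h2] at h1
    rw [one_div, ENNReal.le_rpow_inv_iff (by norm_num), ENNReal.rpow_two]
    exact h1
  have hGfin : ∫⁻ y, G y ≠ ⊤ := by
    have h1 := sq_lintegral_mul_le (μ := volume)
      (f := (Set.Ioo a b).indicator (fun _ => ENNReal.ofReal B)) (g := fun y => ‖g y‖ₑ)
      (measurable_const.indicator measurableSet_Ioo).aemeasurable hg.enorm.aemeasurable
    have h2 : ∀ y, (Set.Ioo a b).indicator (fun _ => ENNReal.ofReal B) y * ‖g y‖ₑ = G y :=
      fun y =>
      (Set.indicator_mul_left (Set.Ioo a b) (fun _ => ENNReal.ofReal B) fun y => ‖g y‖ₑ).symm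
    have h3 : ∫⁻ y, (Set.Ioo a b).indicator (fun _ => ENNReal.ofReal B) y ^ 2 ≠ ⊤ := by
      have h4 : ∀ y, (Set.Ioo a b).indicator (fun _ => ENNReal.ofReal B) y ^ 2 =
          (Set.Ioo a b).indicator (fun _ => ENNReal.ofReal B ^ 2) y := by
        intro y
        by_cases hy : y ∈ Set.Ioo a b <;> simp [hy]
      simp only [h4]
      rw [lintegral_indicator measurableSet_Ioo, setLIntegral_const, Real.volume_Ioo]
      exact ENNReal.mul_ne_top (ENNReal.pow_ne_top ENNReal.ofReal_ne_top) ENNReal.ofReal_ne_top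
    simp only [h2] at h1
    intro htop
    rw [htop, ENNReal.top_pow (by norm_num), top_le_iff] at h1
    exact ENNReal.mul_ne_top h3 hge h1
  calc ∫⁻ p, ‖trilinearIntegrand S φ f g h p‖ₑ
      = ∫⁻ y, ∫⁻ x, ‖trilinearIntegrand S φ f g h (x, y)‖ₑ := by
        rw [Measure.volume_eq_prod, lintegral_prod_symm _ hm.enorm.aemeasurable]
    _ ≤ ∫⁻ y, ∫⁻ x, G y * (‖f x‖ₑ * ‖h (x + y)‖ₑ) :=
        lintegral_mono fun y => lintegral_mono fun x => hpt x y
    _ ≤ ∫⁻ y, G y * (energy f * energy h) ^ (1 / 2 : ℝ) := by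
        refine lintegral_mono fun y => ?_
        rw [lintegral_const_mul _ (by fun_prop)]
        exact mul_le_mul' le_rfl (hCS y)
    _ = (∫⁻ y, G y) * (energy f * energy h) ^ (1 / 2 : ℝ) := lintegral_mul_const _ hGm
    _ < ⊤ := ENNReal.mul_lt_top hGfin.lt_top (ENNReal.rpow_lt_top_of_nonneg (by norm_num)
        (ENNReal.mul_ne_top hfe hhe))

lemma integral_trilinearIntegrand_eq_add {a b z : ℝ} {α β : ℝ → ℝ} {φ : ℝ → ℝ → ℂ} {B : ℝ}
    (hB : 0 ≤ B) (hφ : IsAdapted a b α β φ B) (hz : z ∈ Set.Ioo a b) (S : MvPolynomial (Fin 2) ℝ)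
    {f g h : ℝ → ℂ} (hf : Measurable f) (hg : Measurable g) (hh : Measurable h)
    (hfe : energy f ≠ ⊤) (hge : energy g ≠ ⊤) (hhe : energy h ≠ ⊤) :
    ∫ p, trilinearIntegrand S φ f g h p = (∫ p, trilinearIntegrand S (slab φ a z) f g h p) +
      ∫ p, trilinearIntegrand S (slab φ z b) f g h p := by
  rw [← integral_add
    (integrable_trilinearIntegrand hB (hφ.slab le_rfl hz.1 hz.2.le) S hf hg hh hfe hge hhe)
    (integrable_trilinearIntegrand hB (hφ.slab hz.1.le hz.2 le_rfl) S hf hg hh hfe hge hhe)]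
  have hne : ∀ᵐ p : ℝ × ℝ, p.2 ≠ z :=
    Measure.quasiMeasurePreserving_snd.ae (Measure.ae_ne volume z)
  refine integral_congr_ae ?_
  filter_upwards [hne] with p hp
  have h1 : φ p.1 p.2 = slab φ a z p.1 p.2 + slab φ z b p.1 p.2 := by
    simp only [slab]
    rcases lt_or_gt_of_ne hp with hlt | hlt
    · rw [Set.indicator_of_notMem (s := Set.Ioo z b) (fun h => lt_asymm h.1 hlt), add_zero]
      by_cases h2 : p.2 ∈ Set.Ioo a z
      · rw [Set.indicator_of_mem h2]
      · rw [Set.indicator_of_notMem h2]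
        exact hφ.eq_zero _ _ fun h => h2 ⟨h.1.1, hlt⟩
    · rw [Set.indicator_of_notMem (s := Set.Ioo a z) (fun h => lt_asymm h.2 hlt), zero_add]
      by_cases h2 : p.2 ∈ Set.Ioo z b
      · rw [Set.indicator_of_mem h2]
      · rw [Set.indicator_of_notMem h2]
        exact hφ.eq_zero _ _ fun h => h2 ⟨hlt, h.1.2⟩
  simp only [trilinearIntegrand]
  rw [h1]
  ring

/-- A bound on all pieces that avoid the heights in `F` gives a bound on the whole trapezoid. -/
lemma norm_integral_trilinearIntegrand_le_card {a₀ b₀ : ℝ} {α β : ℝ → ℝ} {B M : ℝ} (hB : 0 ≤ B)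
    (hM : 0 ≤ M) {S : MvPolynomial (Fin 2) ℝ} {f g h : ℝ → ℂ} (hf : Measurable f)
    (hg : Measurable g) (hh : Measurable h) (hfe : energy f ≠ ⊤) (hge : energy g ≠ ⊤)
    (hhe : energy h ≠ ⊤) (F : Finset ℝ)
    (hpiece : ∀ a b φ, a₀ ≤ a → b ≤ b₀ → IsAdapted a b α β φ B → (∀ z ∈ F, z ∉ Set.Ioo a b) →
      ‖∫ p, trilinearIntegrand S φ f g h p‖ ≤ M)
    {a b : ℝ} {φ : ℝ → ℝ → ℂ} (ha : a₀ ≤ a) (hb : b ≤ b₀) (hφ : IsAdapted a b α β φ B) :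
    ‖∫ p, trilinearIntegrand S φ f g h p‖ ≤ (F.card + 1) * M := by
  induction F using Finset.strongInduction generalizing a₀ b₀ a b φ with
  | H F ih =>
    by_cases hfree : ∀ z ∈ F, z ∉ Set.Ioo a b
    · refine (hpiece a b φ ha hb hφ hfree).trans ?_
      nlinarith [Nat.cast_nonneg (α := ℝ) F.card]
    · push Not at hfree
      obtain ⟨z, hzF, hz⟩ := hfree
      have left : F.filter (· < z) ⊂ F :=
        Finset.filter_ssubset.mpr ⟨z, hzF, lt_irrefl z⟩
      have right : F.filter (z < ·) ⊂ F :=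
        Finset.filter_ssubset.mpr ⟨z, hzF, lt_irrefl z⟩
      have h1 := ih _ left (a₀ := a) (b₀ := z) (fun a' b' ψ ha' hb' hψ hav =>
          hpiece a' b' ψ (ha.trans ha') (hb'.trans (hz.2.le.trans hb)) hψ fun w hw hw' =>
            hav w (Finset.mem_filter.mpr ⟨hw, hw'.2.trans_le hb'⟩) hw')
        le_rfl le_rfl (hφ.slab le_rfl hz.1 hz.2.le)
      have h2 := ih _ right (a₀ := z) (b₀ := b) (fun a' b' ψ ha' hb' hψ hav =>
          hpiece a' b' ψ ((ha.trans hz.1.le).trans ha') (hb'.trans hb) hψ fun w hw hw' =>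
            hav w (Finset.mem_filter.mpr ⟨hw, ha'.trans_lt hw'.1⟩) hw')
        le_rfl le_rfl (hφ.slab hz.1.le hz.2 le_rfl)
      -- the two halves share no cut, and neither contains `z`
      have hcard : (F.filter (· < z)).card + (F.filter (z < ·)).card + 1 ≤ F.card := by
        have hd : Disjoint (F.filter (· < z)) (F.filter (z < ·)) :=
          Finset.disjoint_filter.mpr fun w _ h3 h4 => lt_asymm h3 h4
        rw [← Finset.card_union_of_disjoint hd]
        refine Finset.card_lt_card
          ⟨Finset.union_subset left.subset right.subset, fun hsub => ?_⟩
        have := hsub hzF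
        simp at this
      rw [integral_trilinearIntegrand_eq_add hB hφ hz S hf hg hh hfe hge hhe]
      refine (norm_add_le _ _).trans ((add_le_add h1 h2).trans ?_)
      have hcard' : ((F.filter (· < z)).card : ℝ) + (F.filter (z < ·)).card + 1 ≤ F.card := by
        exact_mod_cast hcard
      nlinarith

/-! ### The trilinear estimate on a general trapezoid -/

lemma energy_eq_normL2 {f : ℝ → ℂ} (hf : MemLp f 2 volume) :
    energy f = ENNReal.ofReal (normL2 f ^ 2) := by
  have h1 : energy f = eLpNorm f 2 volume ^ 2 := by
    have h2 := eLpNorm_nnreal_pow_eq_lintegral (f := f) (μ := volume) (p := 2) (by norm_num)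
    simp only [NNReal.coe_ofNat, ENNReal.coe_ofNat, ENNReal.rpow_two] at h2
    exact h2.symm
  rw [h1, normL2, ENNReal.ofReal_pow ENNReal.toReal_nonneg, ENNReal.ofReal_toReal hf.2.ne]

/-- The trilinear estimate for an adapted amplitude, with `|H|` comparable to `μ` on the trapezoid. -/
lemma exists_norm_integral_trilinearIntegrand_le (n : ℕ) (A B : ℝ) (hA : 1 ≤ A) (hB : 0 < B) :
    ∃ C : ℝ, 0 < C ∧ ∀ (S : MvPolynomial (Fin 2) ℝ), S.totalDegree ≤ n →
    ∀ (a b : ℝ) (α β : ℝ → ℝ) (φ : ℝ → ℝ → ℂ), IsAdapted a b α β φ B →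
    ∀ μ : ℝ, 0 < μ → (∀ p ∈ trapezoid a b α β,
      μ ≤ |evalXY (mixedH S) p.1 p.2| ∧ |evalXY (mixedH S) p.1 p.2| ≤ A * μ) →
    ∀ f g h : ℝ → ℂ, Measurable f → Measurable g → Measurable h →
    MemLp f 2 volume → MemLp g 2 volume → MemLp h 2 volume →
    ‖∫ p, trilinearIntegrand S φ f g h p‖ ≤
      C * μ ^ (-(1 / 6) : ℝ) * (normL2 f * normL2 g * normL2 h) := by
  obtain ⟨C, hC, hmain⟩ := exists_enorm_trilinear_sq_le n A B (by linarith) hB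
  refine ⟨(((2 * (4 * n) + 1) * (4 * n) : ℕ) + 1) * √C, by positivity, ?_⟩
  intro S hS a b α β φ hφ μ hμ hH f g h hf hg hh hf2 hg2 hh2
  have hfn : 0 ≤ normL2 f := ENNReal.toReal_nonneg
  have hgn : 0 ≤ normL2 g := ENNReal.toReal_nonneg
  have hhn : 0 ≤ normL2 h := ENNReal.toReal_nonneg
  have hfe : energy f ≠ ⊤ := by rw [energy_eq_normL2 hf2]; exact ENNReal.ofReal_ne_top
  have hge : energy g ≠ ⊤ := by rw [energy_eq_normL2 hg2]; exact ENNReal.ofReal_ne_top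
  have hhe : energy h ≠ ⊤ := by rw [energy_eq_normL2 hh2]; exact ENNReal.ofReal_ne_top
  obtain ⟨F, hF, hgood⟩ := exists_finset_hasGoodChords hA hμ hS hφ.data hH
  set M : ℝ := √C * μ ^ (-(1 / 6) : ℝ) * (normL2 f * normL2 g * normL2 h) with hM
  have hM0 : 0 ≤ M := by positivity
  have hpow : (μ ^ (-(1 / 6) : ℝ)) ^ 2 = μ ^ (-(1 / 3) : ℝ) := by
    rw [← Real.rpow_natCast, ← Real.rpow_mul hμ.le]
    norm_num
  have hpiece : ∀ a' b' ψ, a ≤ a' → b' ≤ b → IsAdapted a' b' α β ψ B →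
      (∀ z ∈ F, z ∉ Set.Ioo a' b') → ‖∫ p, trilinearIntegrand S ψ f g h p‖ ≤ M := by
    intro a' b' ψ ha hb hψ hav
    have h1 := hmain S hS a' b' α β ψ hψ μ hμ (hgood a' b' ha hb hav) f g h hf hg hh hfe hge
    change ‖∫ p, trilinearIntegrand S ψ f g h p‖ₑ ^ 2 ≤ _ at h1
    rw [energy_eq_normL2 hf2, energy_eq_normL2 hg2, energy_eq_normL2 hh2,
      ← ofReal_norm_sq_eq, ← ENNReal.ofReal_mul (by positivity), ← ENNReal.ofReal_mul (by positivity),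
      ← ENNReal.ofReal_mul (by positivity), ENNReal.ofReal_le_ofReal_iff (by positivity)] at h1
    refine (sq_le_sq₀ (norm_nonneg _) hM0).mp (h1.trans_eq ?_)
    rw [hM, mul_pow, mul_pow, Real.sq_sqrt hC.le, hpow]
    ring
  refine (norm_integral_trilinearIntegrand_le_card hB.le hM0 hf hg hh hfe hge hhe F hpiece
    le_rfl le_rfl hφ).trans ?_
  have hF' : (F.card : ℝ) ≤ ((2 * (4 * n) + 1) * (4 * n) : ℕ) := by exact_mod_cast hF
  calc (F.card + 1 : ℝ) * M ≤ (((2 * (4 * n) + 1) * (4 * n) : ℕ) + 1) * M := by gcongr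
    _ = _ := by rw [hM]; ring

lemma evalXY_C_mul (c : ℝ) (P : MvPolynomial (Fin 2) ℝ) (x y : ℝ) :
    evalXY (MvPolynomial.C c * P) x y = c * evalXY P x y := by
  rw [evalXY_mul, evalXY_C]

lemma mixedH_C_mul (c : ℝ) (S : MvPolynomial (Fin 2) ℝ) :
    mixedH (MvPolynomial.C c * S) = MvPolynomial.C c * mixedH S := by
  simp only [mixedH, MvPolynomial.pderiv_C_mul, ← mul_sub]

lemma integrand_ae_eq {lam : ℝ} {S : MvPolynomial (Fin 2) ℝ} {Ω : Set (ℝ × ℝ)} {φ : ℝ → ℝ → ℂ}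
    {f g h f' g' h' : ℝ → ℂ} (hf : f =ᵐ[volume] f') (hg : g =ᵐ[volume] g')
    (hh : h =ᵐ[volume] h') :
    integrand lam S Ω φ f g h =ᵐ[volume]
      trilinearIntegrand (MvPolynomial.C lam * S)
        (fun x y => Ω.indicator (fun p => φ p.1 p.2) (x, y)) f' g' h' := by
  have h1 : ∀ᵐ p : ℝ × ℝ, f p.1 = f' p.1 := Measure.quasiMeasurePreserving_fst.ae hf
  have h2 : ∀ᵐ p : ℝ × ℝ, g p.2 = g' p.2 := Measure.quasiMeasurePreserving_snd.ae hg
  have h3 : ∀ᵐ p : ℝ × ℝ, h (p.1 + p.2) = h' (p.1 + p.2) :=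
    (Measure.quasiMeasurePreserving_fst.comp
      (measurePreserving_shear.symm shear).quasiMeasurePreserving).ae hh
  filter_upwards [h1, h2, h3] with p e1 e2 e3
  rw [integrand, trilinearIntegrand, e1, e2, e3, evalXY_C_mul]
  have h4 : Ω.indicator (fun p => φ p.1 p.2) (p.1, p.2) =
      Ω.indicator (fun _ => (1 : ℂ)) p * φ p.1 p.2 := by
    by_cases hp : p ∈ Ω <;> simp [hp]
  rw [h4]
  ring

end TrilinearVdC
end

theorem mainTheorem4 (n : ℕ) (A B : ℝ) (hA : 1 ≤ A) (hB : 0 < B) :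
    ∃ C : ℝ, 0 < C ∧
      ∀ (S : MvPolynomial (Fin 2) ℝ), S.totalDegree ≤ n →
      ∀ (a b : ℝ) (α β : ℝ → ℝ), TrilinearVdC.IsTrapezoidData a b α β →
      ∀ (φ : ℝ → ℝ → ℂ), Measurable (fun p : ℝ × ℝ => φ p.1 p.2) →
      (∀ y ∈ Set.Ioo a b, ContDiff ℝ ∞ (fun x => φ x y) ∧
        tsupport (fun x => φ x y) ⊆ Set.Icc (α y) (β y)) →
      (∀ p ∈ TrilinearVdC.trapezoid a b α β,
        ∑ k ∈ Finset.range 3,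
          TrilinearVdC.sectionLength (TrilinearVdC.trapezoid a b α β) p.2 ^ k *
            ‖iteratedDeriv k (fun x => φ x p.2) p.1‖ ≤ B) →
      ∀ (μ : ℝ), 0 < μ →
      (∀ p ∈ TrilinearVdC.trapezoid a b α β,
        μ ≤ |TrilinearVdC.evalXY (TrilinearVdC.mixedH S) p.1 p.2| ∧
          |TrilinearVdC.evalXY (TrilinearVdC.mixedH S) p.1 p.2| ≤ A * μ) →
      ∀ (lam : ℝ), lam ≠ 0 →
      ∀ (f g h : ℝ → ℂ), MemLp f 2 volume → MemLp g 2 volume → MemLp h 2 volume →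
        Integrable
          (TrilinearVdC.integrand lam S (TrilinearVdC.trapezoid a b α β) φ f g h) volume ∧
        ‖TrilinearVdC.form lam S (TrilinearVdC.trapezoid a b α β) φ f g h‖ ≤
          C * |lam * μ| ^ (-(1 / 6) : ℝ) *
            (TrilinearVdC.normL2 f * TrilinearVdC.normL2 g * TrilinearVdC.normL2 h) := by
  open TrilinearVdC in
  obtain ⟨C, hC, hmain⟩ := exists_norm_integral_trilinearIntegrand_le n A B hA hB
  refine ⟨C, hC, ?_⟩
  intro S hS a b α β hΩ φ hφ hsm hφB μ hμ hH lam hlam f g h hf hg hh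
  have hψ := isAdapted_indicator hΩ hφ hsm hφB
  -- measurable representatives, and the frequency absorbed into the phase
  set f' := hf.1.mk f with hf'
  set g' := hg.1.mk g with hg'
  set h' := hh.1.mk h with hh'
  have ef : f =ᵐ[volume] f' := hf.1.ae_eq_mk
  have eg : g =ᵐ[volume] g' := hg.1.ae_eq_mk
  have eh : h =ᵐ[volume] h' := hh.1.ae_eq_mk
  have mf : Measurable f' := hf.1.stronglyMeasurable_mk.measurable
  have mg : Measurable g' := hg.1.stronglyMeasurable_mk.measurable
  have mh : Measurable h' := hh.1.stronglyMeasurable_mk.measurable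
  have lf : MemLp f' 2 volume := hf.ae_eq ef
  have lg : MemLp g' 2 volume := hg.ae_eq eg
  have lh : MemLp h' 2 volume := hh.ae_eq eh
  have nf : normL2 f = normL2 f' := congrArg ENNReal.toReal (eLpNorm_congr_ae ef)
  have ng : normL2 g = normL2 g' := congrArg ENNReal.toReal (eLpNorm_congr_ae eg)
  have nh : normL2 h = normL2 h' := congrArg ENNReal.toReal (eLpNorm_congr_ae eh)
  have hae := integrand_ae_eq (lam := lam) (S := S) (Ω := trapezoid a b α β) (φ := φ) ef eg eh
  have finite : ∀ {u : ℝ → ℂ}, MemLp u 2 volume → energy u ≠ ⊤ := fun hu => by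
    rw [energy_eq_normL2 hu]; exact ENNReal.ofReal_ne_top
  refine ⟨(integrable_trilinearIntegrand hB.le hψ (MvPolynomial.C lam * S) mf mg mh (finite lf)
    (finite lg) (finite lh)).congr hae.symm, ?_⟩
  have hlam' : 0 < |lam| := abs_pos.mpr hlam
  have hS' : (MvPolynomial.C lam * S).totalDegree ≤ n := by
    refine (MvPolynomial.totalDegree_mul _ _).trans ?_
    rw [MvPolynomial.totalDegree_C, zero_add]
    exact hS
  have key := hmain (MvPolynomial.C lam * S) hS' a b α β _ hψ (|lam| * μ) (by positivity) (by
    intro p hp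
    obtain ⟨h1, h2⟩ := hH p hp
    rw [mixedH_C_mul, evalXY_C_mul, abs_mul]
    refine ⟨by gcongr, ?_⟩
    rw [mul_left_comm]
    gcongr) f' g' h' mf mg mh lf lg lh
  rw [form, integral_congr_ae hae, nf, ng, nh, abs_mul, abs_of_pos hμ]
  exact key
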